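/- Let $\mathbb T=\mathbb R/2\pi\mathbb Z$, $\int_{\mathbb T} f\,dx:=\frac1{2\pi}\int_{-\pi}^{\pi}f(x)\,dx$, $\hat f(k)=\int_{\mathbb T}f(x)e^{-ikx}\,dx$, $D^\alpha f=\sum_{k\in\mathbb Z}|k|^\alpha\hat f(k)e^{ikx}$, and let $H^s(\mathbb T)$ be the Sobolev space of complex-valued functions with norm $\|f\|_{H^s}=\big(\sum_{k\in\mathbb Z}(1+k^2)^{s}|\hat f(k)|^2\big)^{1/2}$. Let $F(\zeta,\omega,\bar\zeta,\bar\omega)$ be a polynomial with complex coefficients in $\zeta,\omega,\bar\zeta,\bar\omega$, and let $F_\omega=\frac{\partial F}{\partial\omega}=\frac12\big(\frac{\partial F}{\partial a}-i\frac{\partial F}{\partial b}\big)$, where $\omega=a+ib$ with $a,b\in\mathbb R$. Consider the Cauchy problem $$\partial_tu+iD^\alpha u=F(u,\partial_xu,\overline{u},\overline{\partial_xu}),\qquad u|_{t=0}=\phi. \tag{1}$$ For $s>\frac32$, $T>0$ and $\phi\in H^s(\mathbb T)$, a solution of (1) in $H^s(\mathbb T)$ on $[0,T]$ is a function $u\in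 L^\infty([0,T];H^s(\mathbb T))$ such that, for all $\chi\in C_c^\infty([0,T)\times\mathbb T)$, $$-\int_0^T\!\!\int_{\mathbb T}u\,\partial_t\chi\,dx\,dt-\int_{\mathbb T}\phi(x)\chi(0,x)\,dx+i\int_0^T\!\!\int_{\mathbb T}u\,D^\alpha\chi\,dx\,dt=\int_0^T\!\!\int_{\mathbb T}F(u,\partial_xu,\overline{u},\overline{\partial_xu})\,\chi\,dx\,dt.$$ A solution on $[-T,0]$ is a function $u\in L^\infty([-T,0];H^s(\mathbb T))$ such that, for all $\chi\in C_c^\infty((-T,0]\times\mathbb T)$, the same identity holds with $\int_{-T}^0$ in place of $\int_0^T$ and $+\int_{\mathbb T}\phi(x)\chi(0,x)\,dx$ in place of $-\int_{\mathbb T}\phi(x)\chi(0,x)\,dx$. **Theorem.** Let $\alpha>2$ and $s>\max\big(\frac\alpha2+1,\frac52\big)$. Suppose that there exists $\psi\in H^s(\mathbb T)$ such that $$\int_{\mathbb T}\operatorname{Im}F_\omega\big(\psi(x),\partial_x\psi(x),\overline{\psi(x)},\overline{\partial_x\psi(x)}\big)\,dx\neq0.$$ Then there exists $\phi\in H^s(\mathbb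 T)$ such that, for every $T>0$, the Cauchy problem (1) has no solution in $C([0,T];H^s(\mathbb T))$ on $[0,T]$ and no solution in $C([-T,0];H^s(\mathbb T))$ on $[-T,0]$. -/

import Mathlib

open MeasureTheory Set
open scoped ContDiff ENNReal ComplexConjugate

noncomputable section

namespace FNLS

/-- The circle has positive length, so Mathlib's Haar probability measure and Fourier
coefficients are available on it. -/
instance factTwoPiPos : Fact (0 < 2 * Real.pi) := ⟨Real.two_pi_pos⟩

/-- The torus `ℝ / 2πℤ`. -/
abbrev Torus : Type := AddCircle (2 * Real.pi)

/-- The normalized measure `dx / 2π` on the torus. With respect to it, Mathlib's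
`fourierCoeff f k` is `(2π)⁻¹ ∫ f(x) e^{-ikx} dx`, and `fourier k x = e^{ikx}`. -/
abbrev μT : Measure Torus := AddCircle.haarAddCircle

/-- The Japanese bracket `⟨k⟩ = (1 + |k|²)^{1/2}`. -/
def bracket (k : ℤ) : ℝ := Real.sqrt (1 + (k : ℝ) ^ 2)

lemma bracket_pos (k : ℤ) : 0 < bracket k := Real.sqrt_pos.mpr (by positivity)

/-! ### The Sobolev spaces `H^s(𝕋)`, `s ≥ 0` -/

/-- The weighted sequence `⟨k⟩^s f̂(k)`. -/
def weightedCoeff (s : ℝ) (f : Lp ℂ 2 μT) (k : ℤ) : ℂ :=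
  ((bracket k ^ s : ℝ) : ℂ) * fourierCoeff f k

lemma norm_sq_weightedCoeff (s : ℝ) (f : Lp ℂ 2 μT) (k : ℤ) :
    ‖weightedCoeff s f k‖ ^ 2 = bracket k ^ (2 * s) * ‖fourierCoeff f k‖ ^ 2 := by
  have hk := bracket_pos k
  rw [weightedCoeff, norm_mul, mul_pow, Complex.norm_real, Real.norm_eq_abs, sq_abs,
    ← Real.rpow_natCast, ← Real.rpow_mul hk.le]
  congr 2
  push_cast
  ring

lemma weightedCoeff_add (s : ℝ) (f g : Lp ℂ 2 μT) :
    weightedCoeff s (f + g) = weightedCoeff s f + weightedCoeff s g := by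
  ext k
  simp only [weightedCoeff, Pi.add_apply, ← fourierBasis_repr, map_add, lp.coeFn_add]
  ring

lemma weightedCoeff_smul (s : ℝ) (c : ℂ) (f : Lp ℂ 2 μT) :
    weightedCoeff s (c • f) = c • weightedCoeff s f := by
  ext k
  simp only [weightedCoeff, Pi.smul_apply, ← fourierBasis_repr, map_smul, lp.coeFn_smul,
    smul_eq_mul]
  ring

lemma summable_iff_memℓp (s : ℝ) (f : Lp ℂ 2 μT) :
    Summable (fun k : ℤ => bracket k ^ (2 * s) * ‖fourierCoeff f k‖ ^ 2) ↔
      Memℓp (weightedCoeff s f) 2 := by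
  rw [memℓp_gen_iff (by simp)]
  simp only [← norm_sq_weightedCoeff]
  norm_num

/-- The functions `f ∈ L²(𝕋)` with `∑ₖ ⟨k⟩^{2s} |f̂(k)|² < ∞`. -/
def sobolevSubmodule (s : ℝ) : Submodule ℂ (Lp ℂ 2 μT) where
  carrier := {f | Summable (fun k : ℤ => bracket k ^ (2 * s) * ‖fourierCoeff f k‖ ^ 2)}
  zero_mem' := by
    rw [mem_ofPred_eq, summable_iff_memℓp]
    have h := weightedCoeff_smul s 0 0
    rw [zero_smul, zero_smul] at h
    rw [h]
    exact zero_memℓp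
  add_mem' {f g} hf hg := by
    rw [mem_ofPred_eq, summable_iff_memℓp] at *
    rw [weightedCoeff_add]
    exact hf.add hg
  smul_mem' c f hf := by
    rw [mem_ofPred_eq, summable_iff_memℓp] at *
    rw [weightedCoeff_smul]
    exact hf.const_smul c

/-- The Sobolev space `H^s(𝕋)` (for `s ≥ 0`, where all its elements are in `L²`). This is a type
of its own, because it carries the `H^s` norm and not the `L²` norm. -/
def Sobolev (s : ℝ) : Type := sobolevSubmodule s

instance (s : ℝ) : AddCommGroup (Sobolev s) := inferInstanceAs (AddCommGroup (sobolevSubmodule s))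

instance (s : ℝ) : Module ℂ (Sobolev s) := inferInstanceAs (Module ℂ (sobolevSubmodule s))

/-- The underlying `L²` function. -/
def Sobolev.toL2 {s : ℝ} : Sobolev s →ₗ[ℂ] Lp ℂ 2 μT := (sobolevSubmodule s).subtype

/-- An element of `H^s(𝕋)` is used as a function on the torus (through an almost everywhere
representative; every use below is under an integral). -/
instance (s : ℝ) : CoeFun (Sobolev s) (fun _ => Torus → ℂ) := ⟨fun f => f.toL2⟩

/-- `f ↦ (⟨k⟩^s f̂(k))ₖ` as a linear map from `H^s(𝕋)` to `ℓ²(ℤ)`. -/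
def Sobolev.toEll2 (s : ℝ) : Sobolev s →ₗ[ℂ] lp (fun _ : ℤ => ℂ) 2 where
  toFun f := ⟨weightedCoeff s f.toL2, (summable_iff_memℓp s f.toL2).mp f.2⟩
  map_add' f g := Subtype.ext (weightedCoeff_add s f.toL2 g.toL2)
  map_smul' c f := Subtype.ext (weightedCoeff_smul s c f.toL2)

lemma Sobolev.toEll2_injective (s : ℝ) : Function.Injective (Sobolev.toEll2 s) := by
  intro f g h
  refine Subtype.ext (fourierBasis.repr.injective (Subtype.ext (funext fun k => ?_)))
  have hk : weightedCoeff s f.toL2 k = weightedCoeff s g.toL2 k := congrFun (congrArg Subtype.val h) k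
  have hb : ((bracket k ^ s : ℝ) : ℂ) ≠ 0 :=
    Complex.ofReal_ne_zero.mpr (Real.rpow_pos_of_pos (bracket_pos k) s).ne'
  have := mul_left_cancel₀ hb hk
  rw [← fourierBasis_repr, ← fourierBasis_repr] at this
  exact this

/-- The `H^s` norm, see `Sobolev.norm_eq`. -/
instance (s : ℝ) : NormedAddCommGroup (Sobolev s) :=
  NormedAddCommGroup.induced (Sobolev s) (lp (fun _ : ℤ => ℂ) 2) (Sobolev.toEll2 s)
    (Sobolev.toEll2_injective s)

/-- `‖f‖_{H^s} = (∑ₖ ⟨k⟩^{2s} |f̂(k)|²)^{1/2}`. -/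
lemma Sobolev.norm_eq {s : ℝ} (f : Sobolev s) :
    ‖f‖ = Real.sqrt (∑' k : ℤ, bracket k ^ (2 * s) * ‖fourierCoeff f k‖ ^ 2) := by
  have h : ‖f‖ = ‖Sobolev.toEll2 s f‖ := rfl
  rw [h, lp.norm_eq_tsum_rpow (by simp), Real.sqrt_eq_rpow]
  simp only [← norm_sq_weightedCoeff]
  norm_num
  rfl

/-! ### Derivatives -/

/-- The Fourier multiplier with symbol `m`: `∑ₖ m(k) f̂(k) e^{ikx}`. It is only applied where the
series converges absolutely. -/
def fourierMultiplier (m : ℤ → ℂ) (f : Torus → ℂ) (x : Torus) : ℂ :=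
  ∑' k : ℤ, m k * fourierCoeff f k * fourier k x

/-- The derivative `∂ₓ f = ∑ₖ i k f̂(k) e^{ikx}` (absolutely convergent if `f ∈ H^s(𝕋)` with
`s > 3/2`, when it is the continuous representative of the distributional derivative). -/
def dx (f : Torus → ℂ) : Torus → ℂ := fourierMultiplier (fun k => Complex.I * k) f

/-- The fractional derivative `D^α f = ∑ₖ |k|^α f̂(k) e^{ikx}`. -/
def fracD (α : ℝ) (f : Torus → ℂ) : Torus → ℂ :=
  fourierMultiplier (fun k => ((|(k : ℝ)| ^ α : ℝ) : ℂ)) f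

/-! ### The nonlinearity -/

/-- The value `F(ζ, w, ζ̄, w̄)` of a polynomial `F` in four variables. -/
def nonlin (F : MvPolynomial (Fin 4) ℂ) (ζ w : ℂ) : ℂ :=
  MvPolynomial.eval ![ζ, w, conj ζ, conj w] F

/-- The derivative `F_w = ∂F/∂w = ½ (∂F/∂a - i ∂F/∂b)`, `w = a + i b`, at `(ζ, w, ζ̄, w̄)`. -/
def nonlinDw (F : MvPolynomial (Fin 4) ℂ) (ζ w : ℂ) : ℂ :=
  (1 / 2) * (deriv (fun a : ℝ => nonlin F ζ (w + a)) 0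
    - Complex.I * deriv (fun b : ℝ => nonlin F ζ (w + b * Complex.I)) 0)

/-! ### Solutions -/

/-- `χ(t, x)` is smooth on `ℝ × 𝕋`. -/
def IsSmooth (χ : ℝ → Torus → ℂ) : Prop :=
  ContDiff ℝ ∞ (fun p : ℝ × ℝ => χ p.1 (p.2 : Torus))

/-- Test functions on `[0,T) × 𝕋`: they are smooth up to `t = 0` (that is, extend smoothly across
`t = 0`) and vanish for `t` near `T`. -/
def IsTestForward (T : ℝ) (χ : ℝ → Torus → ℂ) : Prop :=
  IsSmooth χ ∧ ∃ T' < T, ∀ t, T' ≤ t → ∀ x, χ t x = 0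

/-- Test functions on `(-T,0] × 𝕋`. -/
def IsTestBackward (T : ℝ) (χ : ℝ → Torus → ℂ) : Prop :=
  IsSmooth χ ∧ ∃ T' < T, ∀ t, t ≤ -T' → ∀ x, χ t x = 0

/-- `u` is a solution in `H^s(𝕋)` on `[0,T]` of
`∂ₜu + i D^α u = F(u, ∂ₓu, ū, conj ∂ₓu)`, `u(0) = φ`: it lies in `L^∞([0,T]; H^s(𝕋))` and
satisfies the equation and the initial condition in the sense of distributions. -/
def IsSolutionForward (α : ℝ) {s : ℝ} (F : MvPolynomial (Fin 4) ℂ) (φ : Sobolev s) (T : ℝ)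
    (u : ℝ → Sobolev s) : Prop :=
  MemLp u ∞ (volume.restrict (Icc 0 T)) ∧
  ∀ χ : ℝ → Torus → ℂ, IsTestForward T χ →
    - (∫ t in (0)..T, ∫ x, u t x * deriv (fun τ => χ τ x) t ∂μT)
      - (∫ x, φ x * χ 0 x ∂μT)
      + Complex.I * (∫ t in (0)..T, ∫ x, u t x * fracD α (χ t) x ∂μT)
    = ∫ t in (0)..T, ∫ x, nonlin F (u t x) (dx (u t) x) * χ t x ∂μT

/-- `u` is a solution in `H^s(𝕋)` on `[-T,0]` with `u(0) = φ`. The sign of the term with `φ` is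
the opposite one, because `t = 0` is the right end of the interval. -/
def IsSolutionBackward (α : ℝ) {s : ℝ} (F : MvPolynomial (Fin 4) ℂ) (φ : Sobolev s) (T : ℝ)
    (u : ℝ → Sobolev s) : Prop :=
  MemLp u ∞ (volume.restrict (Icc (-T) 0)) ∧
  ∀ χ : ℝ → Torus → ℂ, IsTestBackward T χ →
    - (∫ t in (-T)..0, ∫ x, u t x * deriv (fun τ => χ τ x) t ∂μT)
      + (∫ x, φ x * χ 0 x ∂μT)
      + Complex.I * (∫ t in (-T)..0, ∫ x, u t x * fracD α (χ t) x ∂μT)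
    = ∫ t in (-T)..0, ∫ x, nonlin F (u t x) (dx (u t) x) * χ t x ∂μT

end FNLS

end

/-!
# Ill-posedness when `∫ Im F_ω ≠ 0`

Differentiating the equation in `x` gives, for the `k`-th Fourier mode,
`ik ∂ₜû(k) = -i|k|^α (ik û(k)) + ∑ₘ Ĝ(m) (u_xx)^(k-m) + ∑ₘ Ĥ(m) (conj u_xx)^(k-m) + …` with
`G = F_ω` and `H = F_ω̄` evaluated along the solution. The only resonant term is `Ĝ(0) (ik)² û(k)`.
Its real part makes the mode grow or decay at the rate `|k| |Im Ĝ(0)|`, according to the sign of `k`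
and to the direction of time, and `Im Ĝ(0)` is the mean in the hypothesis, at time `0`. At the
frequencies of one sign the modes grow like `e^{κ|k|t}`, so a solution that stays in `H^s` can start
only from a datum that is smoother than a general element of `H^s` at these frequencies.

To make this precise, all the other terms must be negligible:

* `ModeSolution` is the equation for the Fourier modes, obtained from the weak formulation in
  `IsSolutionForward.modeSolution` and `IsSolutionBackward.modeSolution`. Solutions on `[-T,0]` are
  run backward in time, with a sign `σ = -1` in the equation, so that one argument treats both cases.
* `ModeSolution.norm_nonlinearity_sub_sum_le` extracts the principal part with `|m| ≤ M` from the
  nonlinearity. The cutoff `M` is a small power of `|k|`.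
* In the interaction representation (`ModeSolution.exists_interaction`) the terms with `m ≠ 0` and
  those with `H` oscillate in time with a frequency at least `|k|^{α-1}`, where `α - 1 > 1`. As
  `Ĝ(m)` and `Ĥ(m)` are only Hölder continuous in time (`ModeSolution.boundedHolder_poly`), the
  oscillation is exploited by translation over half a period instead of integration by parts
  (`norm_integral_oscillatory_le`), which gains a power of `|k|`.
* The resonant term is absorbed in an integrating factor that decays like `e^{-κ|k|t}`
  (`exists_integratingFactor`). Duhamel's formula then yields `φ̂(k) = O(|k|^{-s-ε})` at all
  frequencies of one sign (`ModeSolution.exists_sign_norm_fourierCoeff_le`).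

Near `ψ` there is a datum `φ` with coefficients of size `|k|^{-s-ε/2}` at the frequencies `±2^j`
(`exists_rough_datum`). By continuity it still satisfies the hypothesis on the mean if it is close
enough to `ψ`, so it has no solution in either direction of time.
-/

namespace FNLS

open Filter Topology

/-! ### Weak equations in time and oscillatory integrals -/

/-- A weak solution of `c' = G`, `c(0) = φ₀` on `[0,T)` satisfies the integrated equation. The test
functions do not vanish at `0`, so that the initial condition is part of the weak formulation. -/
theorem eq_add_integral_of_weak {T : ℝ} (hT : 0 < T) {c G : ℝ → ℂ} {φ₀ : ℂ}
    (hc : Continuous c) (hG : Continuous G)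
    (h : ∀ θ : ℝ → ℝ, ContDiff ℝ ∞ θ → (∃ T' < T, ∀ t, T' ≤ t → θ t = 0) →
      -(∫ t in (0)..T, ((deriv θ t : ℝ) : ℂ) * c t) - φ₀ * (θ 0 : ℂ)
        = ∫ t in (0)..T, (θ t : ℂ) * G t) :
    ∀ t ∈ Icc 0 T, c t = φ₀ + ∫ τ in (0)..t, G τ := by
  set Γ : ℝ → ℂ := fun t => ∫ τ in (0)..t, G τ with hΓ
  have hΓd : ∀ t, HasDerivAt Γ (G t) t := fun t => hG.integral_hasStrictDerivAt 0 t |>.hasDerivAt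
  have hΓc : Continuous Γ := continuous_iff_continuousAt.2 fun t => (hΓd t).continuousAt
  have hf : Continuous fun t => c t - φ₀ - Γ t := by fun_prop
  have key : ∀ᵐ t, t ∈ Ioo 0 T → c t - φ₀ - Γ t = 0 := by
    refine isOpen_Ioo.ae_eq_zero_of_integral_contDiff_smul_eq_zero
      (hf.locallyIntegrable.locallyIntegrableOn _) fun g hg hgc hgs => ?_
    -- the primitive of `g` that vanishes near `T` is an admissible test function
    set θ : ℝ → ℝ := fun t => ∫ τ in T..t, g τ with hθ
    have hθd : ∀ t, HasDerivAt θ (g t) t := fun t =>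
      hg.continuous.integral_hasStrictDerivAt T t |>.hasDerivAt
    have hθ' : deriv θ = g := funext fun t => (hθd t).deriv
    have hgz : ∀ t, t ∉ Ioo 0 T → g t = 0 := fun t ht =>
      image_eq_zero_of_notMem_tsupport fun h' => ht (hgs h')
    obtain ⟨T', hT'T, hT'⟩ : ∃ T' < T, ∀ t, T' ≤ t → θ t = 0 := by
      have hK : IsCompact (insert 0 (tsupport g)) := IsCompact.insert hgc 0
      have hm := hK.sSup_mem (insert_nonempty _ _)
      set S := sSup (insert 0 (tsupport g)) with hS
      have hST : S < T := by
        rcases hm with h0 | h0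
        · rw [h0]; exact hT
        · exact (hgs h0).2
      refine ⟨(S + T) / 2, by linarith, fun t ht => ?_⟩
      have : ∀ x ∈ uIcc T t, g x = 0 := by
        intro x hx
        refine image_eq_zero_of_notMem_tsupport fun h' => ?_
        have h1 : x ≤ S := le_csSup hK.bddAbove (mem_insert_of_mem _ h')
        have h2 : min T t ≤ x := hx.1
        rcases min_le_iff.1 h2 with h3 | h3 <;> linarith
      rw [hθ]
      simp only
      rw [intervalIntegral.integral_congr (g := fun _ => 0) this]
      simp
    have hθs : ContDiff ℝ ∞ θ := contDiff_infty_iff_deriv.2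
      ⟨fun t => (hθd t).differentiableAt, by rw [hθ']; exact hg⟩
    have hw := h θ hθs ⟨T', hT'T, hT'⟩
    rw [hθ'] at hw
    have hθT : θ T = 0 := hT' T hT'T.le
    have hθ0 : θ 0 = -∫ t in (0)..T, g t := intervalIntegral.integral_symm _ _
    have hparts : ∫ t in (0)..T, (θ t : ℂ) * G t = - ∫ t in (0)..T, (g t : ℂ) * Γ t := by
      rw [intervalIntegral.integral_mul_deriv_eq_deriv_mul (u := fun t => (θ t : ℂ)) (v := Γ)
        (u' := fun t => (g t : ℂ)) (fun t _ => (hθd t).ofReal_comp) (fun t _ => hΓd t)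
        ((Complex.continuous_ofReal.comp hg.continuous).intervalIntegrable _ _)
        (hG.intervalIntegrable _ _)]
      have : Γ 0 = 0 := intervalIntegral.integral_same
      rw [hθT, this]
      simp
    rw [hparts, hθ0] at hw
    have e1 : ∫ t, g t • (c t - φ₀ - Γ t) = ∫ t in (0)..T, g t • (c t - φ₀ - Γ t) := by
      rw [intervalIntegral.integral_of_le hT.le, ← integral_indicator measurableSet_Ioc]
      congr 1
      ext t
      by_cases ht : t ∈ Ioc 0 T
      · rw [indicator_of_mem ht]
      · rw [indicator_of_notMem ht, hgz t fun h' => ht ⟨h'.1, h'.2.le⟩, zero_smul]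
    rw [e1]
    have hgc' : Continuous fun t => (g t : ℂ) := Complex.continuous_ofReal.comp hg.continuous
    have e2 : ∀ t, g t • (c t - φ₀ - Γ t) = ((g t : ℂ) * c t - (g t : ℂ) * φ₀) - (g t : ℂ) * Γ t := by
      intro t
      rw [Complex.real_smul]
      ring
    simp_rw [e2]
    have e3 : (∫ t in (0)..T, ((g t : ℂ) * c t - (g t : ℂ) * φ₀) - (g t : ℂ) * Γ t)
        = (∫ t in (0)..T, ((g t : ℂ) * c t - (g t : ℂ) * φ₀)) - ∫ t in (0)..T, (g t : ℂ) * Γ t :=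
      intervalIntegral.integral_sub
        (((hgc'.mul hc).sub (hgc'.mul continuous_const)).intervalIntegrable _ _)
        ((hgc'.mul hΓc).intervalIntegrable _ _)
    have e4 : (∫ t in (0)..T, ((g t : ℂ) * c t - (g t : ℂ) * φ₀))
        = (∫ t in (0)..T, (g t : ℂ) * c t) - ∫ t in (0)..T, (g t : ℂ) * φ₀ :=
      intervalIntegral.integral_sub ((hgc'.mul hc).intervalIntegrable _ _)
        ((hgc'.mul continuous_const).intervalIntegrable _ _)
    rw [e3, e4, intervalIntegral.integral_mul_const,
      intervalIntegral.integral_ofReal]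
    push_cast at hw
    linear_combination -hw
  have hae : (fun t => c t - φ₀ - Γ t) =ᵐ[volume.restrict (Icc 0 T)] fun _ => 0 := by
    rw [← restrict_Ioo_eq_restrict_Icc]
    exact (ae_restrict_iff' measurableSet_Ioo).2 key
  have heq := Measure.eqOn_Icc_of_ae_eq volume hT.ne hae hf.continuousOn continuousOn_const
  intro t ht
  have := heq ht
  simp only at this
  linear_combination this

/-- A cheap substitute for integration by parts against `e^{iΦt}`, for amplitudes that are only
Hölder continuous: translating by half a period `η = π/|Φ|` changes the sign of the
exponential. -/
theorem norm_integral_oscillatory_le {τ Φ B : ℝ} (hτ : 0 ≤ τ) (hΦ : Φ ≠ 0) {H : ℝ → ℂ}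
    {D : ℝ → ℝ} (hH : Continuous H) (hD : Continuous D) (hB : ∀ t ∈ Icc 0 τ, ‖H t‖ ≤ B)
    (hD0 : ∀ t, 0 ≤ D t)
    (hdiff : ∀ t, 0 ≤ t → t + Real.pi / |Φ| ≤ τ → ‖H (t + Real.pi / |Φ|) - H t‖ ≤ D t) :
    ‖∫ t in (0)..τ, H t * Complex.exp (Complex.I * Φ * t)‖
      ≤ B * (Real.pi / |Φ|) + ∫ t in (0)..τ, D t := by
  set η := Real.pi / |Φ| with hη
  have hη0 : 0 < η := div_pos Real.pi_pos (abs_pos.2 hΦ)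
  have hB0 : 0 ≤ B := (norm_nonneg _).trans (hB 0 ⟨le_rfl, hτ⟩)
  set e : ℝ → ℂ := fun t => Complex.exp (Complex.I * Φ * t) with he
  have hec : Continuous e := by fun_prop
  have hen : ∀ t, ‖e t‖ = 1 := by
    intro t
    have : Complex.I * Φ * t = ((Φ * t : ℝ) : ℂ) * Complex.I := by push_cast; ring
    rw [he]; simp only; rw [this, Complex.norm_exp_ofReal_mul_I]
  have hHe : Continuous fun t => H t * e t := hH.mul hec
  have hii : ∀ a b, IntervalIntegrable (fun t => H t * e t) volume a b := fun a b =>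
    hHe.intervalIntegrable a b
  have hpiece : ∀ a b, 0 ≤ a → a ≤ b → b ≤ τ → ‖∫ t in a..b, H t * e t‖ ≤ B * (b - a) := by
    intro a b ha hab hb
    have := intervalIntegral.norm_integral_le_of_norm_le_const (a := a) (b := b) (C := B)
      (f := fun t => H t * e t) fun t ht => by
        rw [uIoc_of_le hab] at ht
        rw [norm_mul, hen, mul_one]
        exact hB t ⟨ha.trans ht.1.le, ht.2.trans hb⟩
    rwa [abs_of_nonneg (sub_nonneg.2 hab)] at this
  have hDint : 0 ≤ ∫ t in (0)..τ, D t := intervalIntegral.integral_nonneg hτ fun t _ => hD0 t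
  rcases le_or_gt τ η with hcase | hcase
  · have := hpiece 0 τ le_rfl hτ le_rfl
    have h2 : B * (τ - 0) ≤ B * η := mul_le_mul_of_nonneg_left (by linarith) hB0
    linarith
  have hshift : ∀ t, e (t + η) = -e t := by
    intro t
    have h1 : Complex.exp (Complex.I * Φ * η) = -1 := by
      rcases lt_or_gt_of_ne hΦ with h | h
      · have : Complex.I * Φ * η = -(Real.pi * Complex.I) := by
          rw [hη, abs_of_neg h]
          have : (Φ : ℂ) ≠ 0 := by exact_mod_cast hΦ
          push_cast
          field_simp
        rw [this, Complex.exp_neg, Complex.exp_pi_mul_I]; norm_num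
      · have : Complex.I * Φ * η = Real.pi * Complex.I := by
          rw [hη, abs_of_pos h]
          have : (Φ : ℂ) ≠ 0 := by exact_mod_cast hΦ
          push_cast
          field_simp
        rw [this, Complex.exp_pi_mul_I]
    rw [he]
    simp only
    push_cast
    rw [mul_add, Complex.exp_add, h1]
    ring
  have hs : ∫ t in η..τ, H t * e t = -∫ t in (0)..(τ - η), H (t + η) * e t := by
    have := intervalIntegral.integral_comp_add_right (a := 0) (b := τ - η)
      (fun t => H t * e t) η
    simp only [zero_add, sub_add_cancel] at this
    rw [← this, ← intervalIntegral.integral_neg]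
    refine intervalIntegral.integral_congr fun t _ => ?_
    simp only [hshift]
    ring
  have hH' : Continuous fun t => H (t + η) * e t := by fun_prop
  have hsplit1 := intervalIntegral.integral_add_adjacent_intervals (hii 0 η) (hii η τ)
  have hsplit2 := intervalIntegral.integral_add_adjacent_intervals (hii 0 (τ - η)) (hii (τ - η) τ)
  -- averaging the integral with its translate leaves two boundary pieces and a difference of `H`
  have htwo : 2 * ∫ t in (0)..τ, H t * e t = (∫ t in (0)..η, H t * e t)
      + (∫ t in (τ - η)..τ, H t * e t)
      - ∫ t in (0)..(τ - η), (H (t + η) - H t) * e t := by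
    have h3 : ∫ t in (0)..(τ - η), (H (t + η) - H t) * e t
        = (∫ t in (0)..(τ - η), H (t + η) * e t) - ∫ t in (0)..(τ - η), H t * e t := by
      rw [← intervalIntegral.integral_sub (hH'.intervalIntegrable _ _) (hii _ _)]
      refine intervalIntegral.integral_congr fun t _ => ?_
      ring
    rw [h3]
    rw [hs] at hsplit1
    linear_combination -hsplit1 - hsplit2
  have hdint : ‖∫ t in (0)..(τ - η), (H (t + η) - H t) * e t‖ ≤ ∫ t in (0)..τ, D t := by
    calc _ ≤ ∫ t in (0)..(τ - η), D t := by
          refine intervalIntegral.norm_integral_le_of_norm_le (by linarith)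
            (Eventually.of_forall fun t ht => ?_) (hD.intervalIntegrable _ _)
          rw [norm_mul, hen, mul_one]
          exact hdiff t ht.1.le (by linarith [ht.2])
      _ ≤ _ := by
          rw [← intervalIntegral.integral_add_adjacent_intervals (hD.intervalIntegrable 0 (τ - η))
            (hD.intervalIntegrable (τ - η) τ)]
          have : 0 ≤ ∫ t in (τ - η)..τ, D t :=
            intervalIntegral.integral_nonneg (by linarith) fun t _ => hD0 t
          linarith
  have h2 : ‖2 * ∫ t in (0)..τ, H t * e t‖ ≤ B * η + B * η + ∫ t in (0)..τ, D t := by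
    rw [htwo]
    refine (norm_sub_le _ _).trans (add_le_add ((norm_add_le _ _).trans (add_le_add ?_ ?_)) hdint)
    · simpa using hpiece 0 η le_rfl hη0.le hcase.le
    · simpa using hpiece (τ - η) τ (by linarith) (by linarith) le_rfl
  rw [norm_mul] at h2
  simp only [Complex.norm_ofNat] at h2
  linarith

theorem integral_exp_neg_mul_le {κ τ : ℝ} (hκ : 0 < κ) :
    ∫ t in (0)..τ, Real.exp (-κ * t) ≤ 1 / κ := by
  rw [intervalIntegral.integral_comp_mul_left (fun x => Real.exp x) (neg_ne_zero.2 hκ.ne'),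
    integral_exp, smul_eq_mul, mul_zero, Real.exp_zero, inv_neg]
  have := Real.exp_pos (-κ * τ)
  rw [one_div]
  have h2 : 0 < κ⁻¹ := inv_pos.2 hκ
  nlinarith

/-- The oscillatory integral of `E·g·v` for an exponentially decaying factor `E` and bounded
factors `g`, `v` with prescribed oscillation over half a period. -/
theorem norm_integral_damped_oscillatory_le {τ Φ κ L Kg Kv ωg ωv : ℝ} (hτ : 0 ≤ τ) (hΦ : Φ ≠ 0)
    (hκ : 0 < κ) (hL : 0 ≤ L) (hKv : 0 ≤ Kv) (hωg : 0 ≤ ωg) (hωv : 0 ≤ ωv)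
    {E g v : ℝ → ℂ} (hE : Continuous E) (hg : Continuous g) (hv : Continuous v)
    (hEb : ∀ t ∈ Icc 0 τ, ‖E t‖ ≤ Real.exp (-κ * t))
    (hEd : ∀ t t', 0 ≤ t → t ≤ t' → t' ≤ τ → ‖E t' - E t‖ ≤ Real.exp (-κ * t) * (L * (t' - t)))
    (hgb : ∀ t ∈ Icc 0 τ, ‖g t‖ ≤ Kg) (hvb : ∀ t ∈ Icc 0 τ, ‖v t‖ ≤ Kv)
    (hgd : ∀ t, 0 ≤ t → t + Real.pi / |Φ| ≤ τ → ‖g (t + Real.pi / |Φ|) - g t‖ ≤ ωg)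
    (hvd : ∀ t, 0 ≤ t → t + Real.pi / |Φ| ≤ τ → ‖v (t + Real.pi / |Φ|) - v t‖ ≤ ωv) :
    ‖∫ t in (0)..τ, E t * (g t * v t) * Complex.exp (Complex.I * Φ * t)‖
      ≤ Kg * Kv * (Real.pi / |Φ|)
        + (L * (Real.pi / |Φ|) * (Kg * Kv) + (ωg * Kv + Kg * ωv)) * (1 / κ) := by
  have hKg : 0 ≤ Kg := (norm_nonneg _).trans (hgb 0 ⟨le_rfl, hτ⟩)
  have hη0 : 0 < Real.pi / |Φ| := div_pos Real.pi_pos (abs_pos.2 hΦ)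
  set η := Real.pi / |Φ| with hη
  have hC0 : 0 ≤ L * η * (Kg * Kv) + (ωg * Kv + Kg * ωv) := by positivity
  -- the factor `1 / κ` in the bound is the integral of the exponential in `D`
  refine (norm_integral_oscillatory_le (B := Kg * Kv)
    (D := fun t => (L * η * (Kg * Kv) + (ωg * Kv + Kg * ωv)) * Real.exp (-κ * t))
    hτ hΦ (by fun_prop) (by fun_prop) ?_ ?_ ?_).trans ?_
  · intro t ht
    rw [norm_mul, norm_mul]
    have h1 : ‖E t‖ ≤ 1 := (hEb t ht).trans (Real.exp_le_one_iff.2 (by nlinarith [ht.1]))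
    calc ‖E t‖ * (‖g t‖ * ‖v t‖) ≤ 1 * (Kg * Kv) := by
          gcongr
          · exact hgb t ht
          · exact hvb t ht
      _ = _ := one_mul _
  · intro t; positivity
  · intro t ht ht'
    rw [← hη] at ht' ⊢
    have hm : t ∈ Icc 0 τ := ⟨ht, by linarith⟩
    have hm' : t + η ∈ Icc 0 τ := ⟨by linarith, ht'⟩
    have hid : E (t + η) * (g (t + η) * v (t + η)) - E t * (g t * v t)
        = (E (t + η) - E t) * (g (t + η) * v (t + η))
          + E t * ((g (t + η) - g t) * v (t + η) + g t * (v (t + η) - v t)) := by ring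
    rw [hid]
    calc _ ≤ ‖E (t + η) - E t‖ * (‖g (t + η)‖ * ‖v (t + η)‖)
          + ‖E t‖ * (‖g (t + η) - g t‖ * ‖v (t + η)‖ + ‖g t‖ * ‖v (t + η) - v t‖) := by
          refine (norm_add_le _ _).trans ?_
          rw [norm_mul, norm_mul, norm_mul]
          gcongr
          refine (norm_add_le _ _).trans ?_
          rw [norm_mul, norm_mul]
      _ ≤ Real.exp (-κ * t) * (L * (t + η - t)) * (Kg * Kv)
          + Real.exp (-κ * t) * (ωg * Kv + Kg * ωv) := by
          gcongr ?_ * (?_ * ?_) + ?_ * (?_ * ?_ + ?_ * ?_)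
          · exact (norm_nonneg _).trans (hEd t (t + η) ht (by linarith) ht')
          · exact hEd t (t + η) ht (by linarith) ht'
          · exact hgb _ hm'
          · exact hvb _ hm'
          · exact hEb t hm
          · exact hgd t ht ht'
          · exact hvb _ hm'
          · exact hgb _ hm
          · exact hvd t ht ht'
      _ = _ := by ring
  · rw [intervalIntegral.integral_const_mul]
    gcongr
    exact integral_exp_neg_mul_le hκ

/-! ### Powers of the bracket -/

theorem one_le_bracket (k : ℤ) : 1 ≤ bracket k := by
  rw [bracket, Real.one_le_sqrt]; nlinarith [sq_nonneg (k : ℝ)]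

theorem abs_le_bracket (k : ℤ) : |(k : ℝ)| ≤ bracket k := by
  rw [bracket]; exact Real.abs_le_sqrt (by linarith)

theorem bracket_neg (k : ℤ) : bracket (-k) = bracket k := by simp [bracket]

theorem bracket_le_two_mul {k m : ℤ} (h : |k| ≤ 2 * |m|) : bracket k ≤ 2 * bracket m := by
  have h' : |(k : ℝ)| ≤ 2 * |(m : ℝ)| := by exact_mod_cast h
  have h1 : (k : ℝ) ^ 2 ≤ (2 * |(m : ℝ)|) ^ 2 := by
    rw [← sq_abs]; gcongr
  rw [mul_pow, sq_abs] at h1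
  rw [bracket, bracket, ← Real.sqrt_sq (by norm_num : (0 : ℝ) ≤ 2), ← Real.sqrt_mul (by norm_num)]
  exact Real.sqrt_le_sqrt (by nlinarith)

theorem bracket_le_two_mul_abs {k : ℤ} (hk : k ≠ 0) : bracket k ≤ 2 * |(k : ℝ)| := by
  have h1 : (1 : ℝ) ≤ |(k : ℝ)| := by exact_mod_cast Int.one_le_abs hk
  rw [bracket]
  refine Real.sqrt_le_iff.2 ⟨by positivity, ?_⟩
  rw [mul_pow, sq_abs]
  nlinarith [sq_abs (k : ℝ)]

theorem bracket_rpow_neg_le {k m : ℤ} (h : |k| ≤ 2 * |m|) {r : ℝ} (hr : 0 ≤ r) :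
    bracket m ^ (-r) ≤ 2 ^ r * bracket k ^ (-r) := by
  have hk := bracket_pos k
  have hm := bracket_pos m
  have h1 := Real.rpow_le_rpow hk.le (bracket_le_two_mul h) hr
  rw [Real.mul_rpow (by norm_num) hm.le] at h1
  rw [Real.rpow_neg hk.le, Real.rpow_neg hm.le, ← div_eq_mul_inv, inv_eq_one_div,
    div_le_div_iff₀ (by positivity) (by positivity)]
  linarith

theorem summable_bracket_rpow {r : ℝ} (hr : 1 < r) : Summable fun k : ℤ => bracket k ^ (-r) := by
  have h0 : Summable fun k : ℤ => |(k : ℝ)| ^ (-r) + if k = 0 then (1 : ℝ) else 0 :=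
    (Real.summable_abs_int_rpow hr).add (summable_of_ne_finset_zero (s := {0}) (by simp_all))
  refine Summable.of_nonneg_of_le (fun k => (Real.rpow_pos_of_pos (bracket_pos k) _).le)
    (fun k => ?_) h0
  rcases eq_or_ne k 0 with rfl | hk
  · have : bracket 0 = 1 := by simp [bracket]
    simp only [this, Real.one_rpow, if_true]
    have : (0 : ℝ) ≤ |((0 : ℤ) : ℝ)| ^ (-r) := by positivity
    linarith
  · rw [if_neg hk, add_zero]
    exact Real.rpow_le_rpow_of_nonpos (abs_pos.2 (by exact_mod_cast hk)) (abs_le_bracket k)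
      (by linarith)

/-- In a convolution, one of the two frequencies is at least half of the output frequency. -/
theorem abs_le_two_mul_or (k m : ℤ) : |k| ≤ 2 * |k - m| ∨ |k| ≤ 2 * |m| := by
  by_contra! h
  have := abs_add_le (k - m) m
  rw [sub_add_cancel] at this
  omega

theorem hasSum_sub_left {E : Type*} [AddCommMonoid E] [TopologicalSpace E] {u : ℤ → E} {a : E}
    (h : HasSum u a) (k : ℤ) : HasSum (fun m => u (k - m)) a :=
  ((Equiv.subLeft k).hasSum_iff (f := u) (a := a)).2 h

/-! ### Fourier coefficients of continuous functions -/

theorem integrable_continuousMap (f : C(Torus, ℂ)) : Integrable f μT :=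
  f.continuous.integrable_of_hasCompactSupport (HasCompactSupport.of_compactSpace _)

/-- The `k`-th Fourier coefficient as a continuous functional on `C(𝕋)`. -/
noncomputable def coeffCLM (k : ℤ) : C(Torus, ℂ) →L[ℂ] ℂ :=
  LinearMap.mkContinuous
    { toFun := fun f => fourierCoeff f k
      map_add' := fun f g => by
        have := congrFun (fourierCoeff.add (integrable_continuousMap f)
          (integrable_continuousMap g)) k
        exact this
      map_smul' := fun c f => fourierCoeff.const_smul (⇑f) c k } 1 (fun f => by
    have : ‖fourierCoeff f k‖ ≤ ‖f‖ * μT.real univ := by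
      refine norm_integral_le_of_norm_le_const (Eventually.of_forall fun x => ?_)
      rw [norm_smul]
      have h1 : ‖fourier (-k) x‖ ≤ 1 := by
        rw [fourier_apply, Circle.norm_coe]
      have h2 := f.norm_coe_le_norm x
      have h3 := norm_nonneg (f x)
      nlinarith [norm_nonneg (fourier (-k) x)]
    simpa using this)

theorem coeffCLM_apply (k : ℤ) (f : C(Torus, ℂ)) : coeffCLM k f = fourierCoeff f k := rfl

theorem fourierCoeff_add (f g : C(Torus, ℂ)) (k : ℤ) :
    fourierCoeff (f + g : C(Torus, ℂ)) k = fourierCoeff f k + fourierCoeff g k :=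
  (coeffCLM k).map_add f g

theorem norm_fourierCoeff_le (f : C(Torus, ℂ)) (k : ℤ) : ‖fourierCoeff f k‖ ≤ ‖f‖ := by
  rw [← coeffCLM_apply]
  refine ((coeffCLM k).le_opNorm f).trans ?_
  have : ‖coeffCLM k‖ ≤ 1 := LinearMap.mkContinuous_norm_le _ zero_le_one _
  nlinarith [norm_nonneg f]

theorem fourierCoeff_fourier_mul (m k : ℤ) (g : C(Torus, ℂ)) :
    fourierCoeff (fourier m * g : C(Torus, ℂ)) k = fourierCoeff g (k - m) := by
  refine integral_congr_ae (Eventually.of_forall fun x => ?_)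
  have : -(k - m) = -k + m := by ring
  simp only [ContinuousMap.coe_mul, Pi.mul_apply, smul_eq_mul]
  rw [this, fourier_add, mul_assoc]

/-- The coefficients of a product are the convolution, if one of the factors has an absolutely
convergent Fourier series. -/
theorem hasSum_fourierCoeff_mul {f : C(Torus, ℂ)} (hf : Summable (fourierCoeff f))
    (g : C(Torus, ℂ)) (k : ℤ) :
    HasSum (fun m => fourierCoeff f m * fourierCoeff g (k - m))
      (fourierCoeff (f * g : C(Torus, ℂ)) k) := by
  have h1 := ((hasSum_fourier_series_of_summable hf).mul_right g).mapL (coeffCLM k)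
  rw [coeffCLM_apply] at h1
  convert h1 using 2 with m
  rw [smul_mul_assoc, map_smul, coeffCLM_apply, fourierCoeff_fourier_mul, smul_eq_mul]

theorem fourierCoeff_star (f : C(Torus, ℂ)) (k : ℤ) :
    fourierCoeff (star f : C(Torus, ℂ)) k = conj (fourierCoeff f (-k)) := by
  rw [fourierCoeff, fourierCoeff, ← integral_conj]
  refine integral_congr_ae (Eventually.of_forall fun x => ?_)
  simp only [ContinuousMap.star_apply, smul_eq_mul, map_mul, neg_neg]
  rw [fourier_neg]
  rfl

/-- The sum `∑ₖ cₖ e^{ikx}` of an absolutely convergent Fourier series (`0` if the series does not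
converge in `C(𝕋)`). -/
noncomputable def synth (c : ℤ → ℂ) : C(Torus, ℂ) := ∑' k, c k • fourier k

theorem summable_smul_fourier {c : ℤ → ℂ} (hc : Summable c) :
    Summable fun k => c k • (fourier k : C(Torus, ℂ)) := by
  refine .of_norm ?_
  simp_rw [norm_smul, fourier_norm, mul_one]
  exact hc.norm

theorem fourierCoeff_synth {c : ℤ → ℂ} (hc : Summable c) : fourierCoeff (synth c) = c := by
  ext k
  rw [← coeffCLM_apply, synth, (coeffCLM k).map_tsum (summable_smul_fourier hc), tsum_eq_single k]
  · rw [map_smul, coeffCLM_apply, fourierCoeff_fourier, Pi.single_eq_same, smul_eq_mul, mul_one]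
  · intro m hm
    rw [map_smul, coeffCLM_apply, fourierCoeff_fourier, Pi.single_eq_of_ne hm.symm, smul_zero]

theorem synth_apply {c : ℤ → ℂ} (hc : Summable c) (x : Torus) :
    synth c x = ∑' k, c k * fourier k x := by
  exact (ContinuousMap.tsum_apply (summable_smul_fourier hc) x).symm

theorem synth_sub {c d : ℤ → ℂ} (hc : Summable c) (hd : Summable d) :
    synth c - synth d = synth fun k => c k - d k := by
  rw [synth, synth, synth, ← (summable_smul_fourier hc).tsum_sub (summable_smul_fourier hd)]
  simp_rw [sub_smul]

theorem norm_synth_le {c : ℤ → ℂ} {g : ℤ → ℝ} {a : ℝ} (hg : HasSum g a) (h : ∀ k, ‖c k‖ ≤ g k) :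
    ‖synth c‖ ≤ a := by
  refine tsum_of_norm_bounded hg fun k => ?_
  rw [norm_smul, fourier_norm, mul_one]
  exact h k

/-! ### Polynomial decay of Fourier coefficients -/

/-- The Fourier coefficients of the family `f` are `O(⟨k⟩^{-r})`, uniformly in the family. -/
def UniformDecay {ι : Type*} (r : ℝ) (f : ι → C(Torus, ℂ)) : Prop :=
  ∃ K : ℝ, 0 ≤ K ∧ ∀ i k, ‖fourierCoeff (f i) k‖ ≤ K * bracket k ^ (-r)

section

variable {ι : Type*} {r : ℝ} {f g : ι → C(Torus, ℂ)}

theorem UniformDecay.summable (hr : 1 < r) (hf : UniformDecay r f) (i : ι) :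
    Summable (fourierCoeff (f i)) := by
  obtain ⟨K, _, hK⟩ := hf
  exact .of_norm_bounded ((summable_bracket_rpow hr).mul_left K) (hK i)

theorem UniformDecay.add (hf : UniformDecay r f) (hg : UniformDecay r g) :
    UniformDecay r fun i => f i + g i := by
  obtain ⟨K, hK0, hK⟩ := hf
  obtain ⟨L, hL0, hL⟩ := hg
  refine ⟨K + L, by positivity, fun i k => ?_⟩
  rw [fourierCoeff_add, add_mul]
  exact norm_add_le_of_le (hK i k) (hL i k)

theorem UniformDecay.star (hf : UniformDecay r f) : UniformDecay r fun i => star (f i) := by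
  obtain ⟨K, hK0, hK⟩ := hf
  refine ⟨K, hK0, fun i k => ?_⟩
  rw [fourierCoeff_star, RCLike.norm_conj, ← bracket_neg k]
  exact hK i (-k)

theorem uniformDecay_const (c : ℂ) (r : ℝ) :
    UniformDecay r fun _ : ι => algebraMap ℂ C(Torus, ℂ) c := by
  refine ⟨‖c‖, norm_nonneg _, fun i k => ?_⟩
  have h0 : algebraMap ℂ C(Torus, ℂ) c = c • (fourier 0 : C(Torus, ℂ)) := by
    ext x
    simp
  rw [h0, ← coeffCLM_apply, map_smul, coeffCLM_apply, fourierCoeff_fourier, norm_smul]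
  rcases eq_or_ne k 0 with rfl | hk
  · simp [bracket]
  · rw [Pi.single_eq_of_ne hk, norm_zero, mul_zero]
    have := bracket_pos k
    positivity

/-- For `r > 1` the decay class is an algebra: in the convolution `∑ₘ f̂(m) ĝ(k-m)` one of `m` and
`k - m` is at least `|k|/2`. -/
theorem UniformDecay.mul (hr : 1 < r) (hf : UniformDecay r f) (hg : UniformDecay r g) :
    UniformDecay r fun i => f i * g i := by
  have hfs := hf.summable hr
  obtain ⟨K, hK0, hK⟩ := hf
  obtain ⟨L, hL0, hL⟩ := hg
  have hS := summable_bracket_rpow hr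
  set S := ∑' k : ℤ, bracket k ^ (-r) with hSdef
  have hbp : ∀ (k : ℤ) (r : ℝ), 0 < bracket k ^ r := fun k r => Real.rpow_pos_of_pos (bracket_pos k) r
  have hS0 : 0 ≤ S := tsum_nonneg fun k => (hbp k _).le
  refine ⟨K * L * (2 ^ r * (S + S)), by positivity, fun i k => ?_⟩
  have h2 : HasSum (fun m : ℤ => bracket (k - m) ^ (-r)) S :=
    hasSum_sub_left hS.hasSum k
  have h1 : HasSum (fun m : ℤ => K * L * (2 ^ r * bracket k ^ (-r) * (bracket m ^ (-r)
      + bracket (k - m) ^ (-r)))) (K * L * (2 ^ r * bracket k ^ (-r) * (S + S))) :=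
    ((hS.hasSum.add h2).mul_left _).mul_left _
  suffices hpt : ∀ m, ‖fourierCoeff (f i) m * fourierCoeff (g i) (k - m)‖
      ≤ K * L * (2 ^ r * bracket k ^ (-r) * (bracket m ^ (-r) + bracket (k - m) ^ (-r))) by
    have h3 := HasSum.norm_le_of_bounded (hasSum_fourierCoeff_mul (hfs i) (g i) k) h1 hpt
    have h4 : K * L * (2 ^ r * bracket k ^ (-r) * (S + S))
        = K * L * (2 ^ r * (S + S)) * bracket k ^ (-r) := by ring
    rwa [h4] at h3
  intro m
  rw [norm_mul]
  calc _ ≤ (K * bracket m ^ (-r)) * (L * bracket (k - m) ^ (-r)) :=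
        mul_le_mul (hK i m) (hL i (k - m)) (norm_nonneg _) (mul_nonneg hK0 (hbp _ _).le)
    _ = K * L * (bracket m ^ (-r) * bracket (k - m) ^ (-r)) := by ring
    _ ≤ _ := by
        refine mul_le_mul_of_nonneg_left ?_ (mul_nonneg hK0 hL0)
        have ha := hbp m (-r)
        have hb := hbp (k - m) (-r)
        have hc := hbp k (-r)
        rcases abs_le_two_mul_or k m with h | h
        · have := bracket_rpow_neg_le h (by linarith : 0 ≤ r)
          calc _ ≤ bracket m ^ (-r) * (2 ^ r * bracket k ^ (-r)) := by gcongr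
            _ ≤ _ := by
              have : 0 ≤ 2 ^ r * bracket k ^ (-r) * bracket (k - m) ^ (-r) := by positivity
              linarith
        · have := bracket_rpow_neg_le h (by linarith : 0 ≤ r)
          calc _ ≤ (2 ^ r * bracket k ^ (-r)) * bracket (k - m) ^ (-r) := by gcongr
            _ ≤ _ := by
              have : 0 ≤ 2 ^ r * bracket k ^ (-r) * bracket m ^ (-r) := by positivity
              linarith

theorem UniformDecay.mono {r' : ℝ} (h : r' ≤ r) (hf : UniformDecay r f) : UniformDecay r' f := by
  obtain ⟨K, hK0, hK⟩ := hf
  refine ⟨K, hK0, fun i k => (hK i k).trans (mul_le_mul_of_nonneg_left ?_ hK0)⟩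
  exact Real.rpow_le_rpow_of_exponent_le (one_le_bracket k) (by linarith)

theorem UniformDecay.aeval (hr : 1 < r) {X : ι → Fin 4 → C(Torus, ℂ)}
    (hX : ∀ j, UniformDecay r fun i => X i j) (F : MvPolynomial (Fin 4) ℂ) :
    UniformDecay r fun i => MvPolynomial.aeval (X i) F := by
  induction F using MvPolynomial.induction_on with
  | C a => simpa using uniformDecay_const a r
  | add p q hp hq => simpa using hp.add hq
  | mul_X p j hp => simpa using hp.mul hr (hX j)

/-- Truncation of the convolution `∑ₘ f̂(m) ĝ(k-m)` to low frequencies `m` of the smoother factor.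
Of the remaining terms, those with `|k-m| ≥ |k|/2` are small because `|m| > M`, and those with
`|m| ≥ |k|/2` because of the decay of `f̂`. The exponent `1/4` is small enough for
`⟨m⟩^{-(s-1-1/4)}` to be summable. -/
theorem norm_fourierCoeff_mul_sub_sum_le {s : ℝ} (hs : 5 / 2 < s) :
    ∃ C : ℝ, 0 ≤ C ∧ ∀ (f g : C(Torus, ℂ)) (K L : ℝ), 0 ≤ K → 0 ≤ L →
      (∀ m, ‖fourierCoeff f m‖ ≤ K * bracket m ^ (-(s - 1))) →
      (∀ m, ‖fourierCoeff g m‖ ≤ L * bracket m ^ (-(s - 2))) →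
      Summable (fun m => ‖fourierCoeff g m‖) → ∑' m, ‖fourierCoeff g m‖ ≤ L →
      ∀ (k : ℤ) (M : ℕ), ‖fourierCoeff (f * g : C(Torus, ℂ)) k
          - ∑ m ∈ Finset.Icc (-(M : ℤ)) M, fourierCoeff f m * fourierCoeff g (k - m)‖
        ≤ C * (K * L) * (bracket k ^ (-(s - 2)) * (1 + M : ℝ) ^ (-(1 / 4) : ℝ)
          + bracket k ^ (-(s - 1))) := by
  have hbp : ∀ (k : ℤ) (r : ℝ), 0 < bracket k ^ r := fun k r => Real.rpow_pos_of_pos (bracket_pos k) r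
  have hS := summable_bracket_rpow (r := s - 5 / 4) (by linarith)
  obtain ⟨S, hSdef⟩ : ∃ S, S = ∑' k : ℤ, bracket k ^ (-(s - 5 / 4)) := ⟨_, rfl⟩
  have hS0 : 0 ≤ S := hSdef ▸ tsum_nonneg fun k => (hbp k _).le
  refine ⟨2 ^ (s - 1) * (S + 1), by positivity, fun f g K L hK0 hL0 hf hg hgs hgL k M => ?_⟩
  have hfs : Summable (fourierCoeff f) :=
    .of_norm_bounded ((summable_bracket_rpow (r := s - 1) (by linarith)).mul_left K) hf
  have hconv := hasSum_fourierCoeff_mul hfs g k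
  set I := Finset.Icc (-(M : ℤ)) M with hI
  have hfin : HasSum (fun m => if m ∈ I then fourierCoeff f m * fourierCoeff g (k - m) else 0)
      (∑ m ∈ I, fourierCoeff f m * fourierCoeff g (k - m)) := by
    rw [Finset.sum_congr rfl fun m hm => (if_pos hm).symm]
    exact hasSum_sum_of_ne_finset_zero fun m hm => if_neg hm
  have hg2 : HasSum (fun m : ℤ => ‖fourierCoeff g (k - m)‖) (∑' m, ‖fourierCoeff g m‖) :=
    hasSum_sub_left hgs.hasSum k
  set Mr := (1 + M : ℝ) ^ (-(1 / 4) : ℝ) with hMr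
  have hMr0 : 0 ≤ Mr := by positivity
  have hbd := ((hS.hasSum.mul_left (K * L * 2 ^ (s - 2) * bracket k ^ (-(s - 2)) * Mr)).add
    (hg2.mul_left (K * 2 ^ (s - 1) * bracket k ^ (-(s - 1)))))
  rw [← hSdef] at hbd
  have hdiff : HasSum (fun m => fourierCoeff f m * fourierCoeff g (k - m)
        - if m ∈ I then fourierCoeff f m * fourierCoeff g (k - m) else 0)
      (fourierCoeff (f * g : C(Torus, ℂ)) k
        - ∑ m ∈ I, fourierCoeff f m * fourierCoeff g (k - m)) := hconv.sub hfin
  have hpt : ∀ m, ‖fourierCoeff f m * fourierCoeff g (k - m)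
        - if m ∈ I then fourierCoeff f m * fourierCoeff g (k - m) else 0‖
      ≤ K * L * 2 ^ (s - 2) * bracket k ^ (-(s - 2)) * Mr * bracket m ^ (-(s - 5 / 4))
        + K * 2 ^ (s - 1) * bracket k ^ (-(s - 1)) * ‖fourierCoeff g (k - m)‖ := by
    intro m
    have p1 : 0 ≤ K * L * 2 ^ (s - 2) * bracket k ^ (-(s - 2)) * Mr * bracket m ^ (-(s - 5 / 4)) := by
      have := hbp k (-(s - 2)); have := hbp m (-(s - 5 / 4)); positivity
    have p2 : 0 ≤ K * 2 ^ (s - 1) * bracket k ^ (-(s - 1)) * ‖fourierCoeff g (k - m)‖ := by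
      have := hbp k (-(s - 1)); positivity
    by_cases hm : m ∈ I
    · rw [if_pos hm, sub_self, norm_zero]
      exact add_nonneg p1 p2
    rw [if_neg hm, sub_zero, norm_mul]
    rcases abs_le_two_mul_or k m with h | h
    · suffices q : ‖fourierCoeff f m‖ * ‖fourierCoeff g (k - m)‖ ≤
          K * L * 2 ^ (s - 2) * bracket k ^ (-(s - 2)) * Mr * bracket m ^ (-(s - 5 / 4)) by
        linarith only [q, p2]
      have h1 := bracket_rpow_neg_le h (by linarith : 0 ≤ s - 2)
      have hMm : (1 + M : ℝ) ≤ bracket m := by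
        refine le_trans ?_ (abs_le_bracket m)
        have : (1 + M : ℤ) ≤ |m| := by
          rw [hI, Finset.mem_Icc, ← abs_le] at hm
          omega
        exact_mod_cast this
      have h2 : bracket m ^ (-(1 / 4) : ℝ) ≤ Mr :=
        Real.rpow_le_rpow_of_nonpos (by positivity) hMm (by norm_num)
      have h3 : bracket m ^ (-(s - 1)) = bracket m ^ (-(s - 5 / 4)) * bracket m ^ (-(1 / 4) : ℝ) := by
        rw [← Real.rpow_add (bracket_pos m)]; congr 1; ring
      have q1 := hbp m (-(s - 5 / 4))
      have q2 := hbp (k - m) (-(s - 2))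
      have q3 := hbp k (-(s - 2))
      calc _ ≤ (K * bracket m ^ (-(s - 1))) * (L * bracket (k - m) ^ (-(s - 2))) :=
            mul_le_mul (hf m) (hg _) (norm_nonneg _) (mul_nonneg hK0 (hbp _ _).le)
        _ ≤ (K * (bracket m ^ (-(s - 5 / 4)) * Mr)) * (L * (2 ^ (s - 2) * bracket k ^ (-(s - 2)))) := by
            rw [h3]; gcongr
        _ = _ := by ring
    · suffices q : ‖fourierCoeff f m‖ * ‖fourierCoeff g (k - m)‖ ≤
          K * 2 ^ (s - 1) * bracket k ^ (-(s - 1)) * ‖fourierCoeff g (k - m)‖ by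
        linarith only [q, p1]
      have h1 := bracket_rpow_neg_le h (by linarith : 0 ≤ s - 1)
      calc _ ≤ (K * (2 ^ (s - 1) * bracket k ^ (-(s - 1)))) * ‖fourierCoeff g (k - m)‖ := by
            gcongr
            exact (hf m).trans (by gcongr)
        _ = _ := by ring
  · have hmain := HasSum.norm_le_of_bounded hdiff hbd hpt
    have h1 : (2 : ℝ) ^ (s - 2) ≤ 2 ^ (s - 1) :=
      Real.rpow_le_rpow_of_exponent_le (by norm_num) (by linarith)
    have alg : ∀ A₀ A b₁ b₂ N : ℝ, A₀ ≤ A → 0 ≤ A → 0 ≤ b₁ → 0 ≤ b₂ → N ≤ L →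
        K * L * A₀ * b₂ * Mr * S + K * A * b₁ * N ≤ A * (S + 1) * (K * L) * (b₂ * Mr + b₁) := by
      intro A₀ A b₁ b₂ N h1 hA q1 q3 hN
      have h2 : K * (A * b₁) * N ≤ K * (A * b₁) * L := by gcongr
      have h3 : A₀ * S ≤ A * (S + 1) := by nlinarith
      have h4 : K * L * b₂ * Mr * (A₀ * S) ≤ K * L * b₂ * Mr * (A * (S + 1)) := by gcongr
      have h5 : 0 ≤ K * L * b₁ * (A * S) := by positivity
      linarith
    exact hmain.trans (alg _ _ _ _ _ h1 (by positivity) (hbp _ _).le (hbp _ _).le hgL)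

/-! ### Differentiation on the Fourier side -/

/-- The chain rule for polynomials, on the Fourier side: `(F(f))' = ∑ⱼ (∂ⱼF)(f) fⱼ'`. The
derivatives `fⱼ'` only need to be continuous. -/
theorem fourierCoeff_sum_pderiv_mul {n : Type*} [Fintype n] [DecidableEq n]
    {X X' : n → C(Torus, ℂ)}
    (hsum : ∀ F : MvPolynomial n ℂ, Summable (fourierCoeff (MvPolynomial.aeval X F : C(Torus, ℂ))))
    (hX : ∀ j k, fourierCoeff (X' j) k = Complex.I * k * fourierCoeff (X j) k)
    (F : MvPolynomial n ℂ) (k : ℤ) :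
    fourierCoeff (∑ j, MvPolynomial.aeval X (MvPolynomial.pderiv j F) * X' j : C(Torus, ℂ)) k
      = Complex.I * k * fourierCoeff (MvPolynomial.aeval X F : C(Torus, ℂ)) k := by
  induction F using MvPolynomial.induction_on generalizing k with
  | C a =>
    simp only [MvPolynomial.pderiv_C, map_zero, zero_mul, Finset.sum_const_zero]
    rw [← coeffCLM_apply, map_zero, MvPolynomial.aeval_C]
    have h0 : algebraMap ℂ C(Torus, ℂ) a = a • (fourier 0 : C(Torus, ℂ)) := by
      ext x
      simp
    rw [h0, ← coeffCLM_apply, map_smul, coeffCLM_apply, fourierCoeff_fourier]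
    rcases eq_or_ne k 0 with rfl | hk
    · simp
    · simp [Pi.single_eq_of_ne hk]
  | add p q hp hq =>
    have e1 : ∑ j, MvPolynomial.aeval X (MvPolynomial.pderiv j (p + q)) * X' j
        = (∑ j, MvPolynomial.aeval X (MvPolynomial.pderiv j p) * X' j)
          + ∑ j, MvPolynomial.aeval X (MvPolynomial.pderiv j q) * X' j := by
      rw [← Finset.sum_add_distrib]
      exact Finset.sum_congr rfl fun j _ => by rw [map_add, map_add, add_mul]
    have e2 : MvPolynomial.aeval X (p + q) = MvPolynomial.aeval X p + MvPolynomial.aeval X q :=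
      map_add _ _ _
    rw [e1, e2, fourierCoeff_add, fourierCoeff_add, hp, hq]
    ring
  | mul_X p j hp =>
    have hXs : Summable (fourierCoeff (X j)) := by
      have := hsum (MvPolynomial.X j)
      rwa [MvPolynomial.aeval_X] at this
    have e1 : ∑ i, MvPolynomial.aeval X (MvPolynomial.pderiv i (p * MvPolynomial.X j)) * X' i
        = MvPolynomial.aeval X p * X' j
          + X j * ∑ i, MvPolynomial.aeval X (MvPolynomial.pderiv i p) * X' i := by
      have e3 : ∀ i, MvPolynomial.aeval X (MvPolynomial.pderiv i (p * MvPolynomial.X j)) * X' i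
          = (if i = j then MvPolynomial.aeval X p * X' j else 0)
            + X j * (MvPolynomial.aeval X (MvPolynomial.pderiv i p) * X' i) := by
        intro i
        rw [Derivation.leibniz, smul_eq_mul, smul_eq_mul, map_add, map_mul, map_mul,
          MvPolynomial.aeval_X, MvPolynomial.pderiv_X]
        split_ifs with h
        · subst h
          rw [Pi.single_eq_same, map_one]
          ring
        · rw [Pi.single_eq_of_ne (Ne.symm h), map_zero]
          ring
      rw [Finset.sum_congr rfl fun i _ => e3 i, Finset.sum_add_distrib, ← Finset.mul_sum,
        Finset.sum_ite_eq' Finset.univ j, if_pos (Finset.mem_univ j)]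
    have e2 : MvPolynomial.aeval X (p * MvPolynomial.X j) = MvPolynomial.aeval X p * X j := by
      rw [map_mul, MvPolynomial.aeval_X]
    rw [e1, e2, fourierCoeff_add]
    have h1 := hasSum_fourierCoeff_mul (hsum p) (X' j) k
    have h2 := hasSum_fourierCoeff_mul hXs
      (∑ i, MvPolynomial.aeval X (MvPolynomial.pderiv i p) * X' i) k
    have h2' := hasSum_sub_left h2 k
    have h3 := (hasSum_fourierCoeff_mul (hsum p) (X j) k).mul_left (Complex.I * k)
    have h4 : (fun m => fourierCoeff (MvPolynomial.aeval X p : C(Torus, ℂ)) m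
          * fourierCoeff (X' j) (k - m)
        + fourierCoeff (X j) (k - m) * fourierCoeff (∑ i, MvPolynomial.aeval X
          (MvPolynomial.pderiv i p) * X' i : C(Torus, ℂ)) (k - (k - m)))
        = fun m => Complex.I * k * (fourierCoeff (MvPolynomial.aeval X p : C(Torus, ℂ)) m
          * fourierCoeff (X j) (k - m)) := by
      ext m
      rw [sub_sub_cancel, hX, hp]
      push_cast
      ring
    have h5 := h1.add h2'
    rw [h4] at h5
    exact h5.unique h3

end

/-! ### Sobolev functions as continuous functions -/

section

variable {s : ℝ}

theorem fourierCoeff_sobolev_sub (f g : Sobolev s) (k : ℤ) :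
    fourierCoeff (f - g : Sobolev s) k = fourierCoeff f k - fourierCoeff g k := by
  have h : ∀ u : Lp ℂ 2 μT, fourierCoeff u k = fourierBasis.repr u k := fun u =>
    (fourierBasis_repr u k).symm
  rw [h, h, h, map_sub, map_sub]
  rfl

theorem norm_fourierCoeff_sobolev_le (f : Sobolev s) (k : ℤ) :
    ‖fourierCoeff f k‖ ≤ ‖f‖ * bracket k ^ (-s) := by
  have h1 : ‖Sobolev.toEll2 s f k‖ ≤ ‖f‖ := lp.norm_apply_le_norm (by norm_num) _ k
  have h2 : ‖Sobolev.toEll2 s f k‖ = bracket k ^ s * ‖fourierCoeff f k‖ := by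
    change ‖((bracket k ^ s : ℝ) : ℂ) * fourierCoeff f k‖ = _
    rw [norm_mul, Complex.norm_real, Real.norm_of_nonneg (Real.rpow_nonneg (bracket_pos k).le _)]
  have h3 := Real.rpow_pos_of_pos (bracket_pos k) s
  rw [Real.rpow_neg (bracket_pos k).le, ← div_eq_mul_inv, le_div_iff₀ h3, mul_comm, ← h2]
  exact h1

/-- Cauchy–Schwarz: `∑ₖ ⟨k⟩² |f̂(k)| ≤ C ‖f‖_{H^s}` for `s > 5/2`. -/
theorem summable_sq_bracket_mul_norm (hs : 5 / 2 < s) :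
    ∃ C : ℝ, 0 ≤ C ∧ ∀ f : Sobolev s,
      Summable (fun k : ℤ => bracket k ^ 2 * ‖fourierCoeff f k‖) ∧
      ∑' k : ℤ, bracket k ^ 2 * ‖fourierCoeff f k‖ ≤ C * ‖f‖ := by
  have hS : Summable fun k : ℤ => (bracket k ^ (2 - s)) ^ (2 : ℝ) := by
    have := summable_bracket_rpow (r := 2 * (s - 2)) (by linarith)
    refine this.congr fun k => ?_
    rw [← Real.rpow_mul (bracket_pos k).le]
    congr 1
    ring
  refine ⟨(∑' k : ℤ, (bracket k ^ (2 - s)) ^ (2 : ℝ)) ^ (1 / 2 : ℝ),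
    Real.rpow_nonneg (tsum_nonneg fun k =>
      Real.rpow_nonneg (Real.rpow_nonneg (bracket_pos k).le _) _) _, fun f => ?_⟩
  have hpt : ∀ k : ℤ, bracket k ^ 2 * ‖fourierCoeff f k‖
      = bracket k ^ (2 - s) * (bracket k ^ s * ‖fourierCoeff f k‖) := by
    intro k
    rw [← mul_assoc, ← Real.rpow_add (bracket_pos k), sub_add_cancel, Real.rpow_two]
  have hsq : ∀ k : ℤ, (bracket k ^ s * ‖fourierCoeff f k‖) ^ (2 : ℝ)
      = bracket k ^ (2 * s) * ‖fourierCoeff f k‖ ^ 2 := by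
    intro k
    rw [Real.rpow_two, mul_pow, ← Real.rpow_natCast, ← Real.rpow_mul (bracket_pos k).le]
    congr 2
    push_cast
    ring
  have hf : Summable fun k : ℤ => (bracket k ^ s * ‖fourierCoeff f k‖) ^ (2 : ℝ) := by
    simp_rw [hsq]
    exact f.2
  have hnn : ∀ k : ℤ, 0 ≤ bracket k ^ s * ‖fourierCoeff f k‖ := fun k =>
    mul_nonneg (Real.rpow_nonneg (bracket_pos k).le _) (norm_nonneg _)
  obtain ⟨h1, h2⟩ := Real.summable_and_inner_le_Lp_mul_Lq_tsum_of_nonneg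
    Real.HolderConjugate.two_two (fun k => Real.rpow_nonneg (bracket_pos k).le _) hnn hS hf
  simp_rw [hpt]
  refine ⟨h1, h2.trans (le_of_eq ?_)⟩
  rw [Sobolev.norm_eq, Real.sqrt_eq_rpow]
  simp_rw [hsq]

/-- The continuous representative of the `j`-th derivative. It is used for `j ≤ 2` and `s > 5/2`
only, where its Fourier series converges absolutely. -/
noncomputable def Sobolev.jet (j : ℕ) (f : Sobolev s) : C(Torus, ℂ) :=
  synth fun k => (Complex.I * k) ^ j * fourierCoeff f k

theorem norm_I_mul_pow (j : ℕ) (k : ℤ) : ‖(Complex.I * k : ℂ) ^ j‖ = |(k : ℝ)| ^ j := by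
  rw [norm_pow, norm_mul, Complex.norm_I, one_mul, Complex.norm_intCast]

theorem norm_jet_coeff_le {j : ℕ} (hj : j ≤ 2) (f : Sobolev s) (k : ℤ) :
    ‖(Complex.I * k : ℂ) ^ j * fourierCoeff f k‖ ≤ bracket k ^ 2 * ‖fourierCoeff f k‖ := by
  rw [norm_mul, norm_I_mul_pow]
  gcongr
  calc |(k : ℝ)| ^ j ≤ bracket k ^ j := by gcongr; exact abs_le_bracket k
    _ ≤ bracket k ^ 2 := pow_le_pow_right₀ (one_le_bracket k) hj

theorem summable_jet_coeff (hs : 5 / 2 < s) {j : ℕ} (hj : j ≤ 2) (f : Sobolev s) :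
    Summable fun k : ℤ => (Complex.I * k : ℂ) ^ j * fourierCoeff f k := by
  obtain ⟨C, _, hC⟩ := summable_sq_bracket_mul_norm hs
  exact .of_norm_bounded (hC f).1 (norm_jet_coeff_le hj f)

theorem fourierCoeff_jet (hs : 5 / 2 < s) {j : ℕ} (hj : j ≤ 2) (f : Sobolev s) (k : ℤ) :
    fourierCoeff (f.jet j) k = (Complex.I * k) ^ j * fourierCoeff f k :=
  congrFun (fourierCoeff_synth (summable_jet_coeff hs hj f)) k

theorem norm_fourierCoeff_jet_le (hs : 5 / 2 < s) {j : ℕ} (hj : j ≤ 2) (f : Sobolev s) (k : ℤ) :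
    ‖fourierCoeff (f.jet j) k‖ ≤ ‖f‖ * bracket k ^ (-(s - j)) := by
  rw [fourierCoeff_jet hs hj, norm_mul, norm_I_mul_pow]
  calc _ ≤ bracket k ^ j * (‖f‖ * bracket k ^ (-s)) := by
        have := bracket_pos k
        gcongr
        · exact abs_le_bracket k
        · exact norm_fourierCoeff_sobolev_le f k
    _ = _ := by
        rw [← Real.rpow_natCast, mul_left_comm, ← Real.rpow_add (bracket_pos k)]
        congr 2
        ring

theorem jet_sub (hs : 5 / 2 < s) {j : ℕ} (hj : j ≤ 2) (f g : Sobolev s) :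
    f.jet j - g.jet j = (f - g).jet j := by
  rw [Sobolev.jet, Sobolev.jet, synth_sub (summable_jet_coeff hs hj f) (summable_jet_coeff hs hj g)]
  simp_rw [Sobolev.jet, fourierCoeff_sobolev_sub, mul_sub]

theorem norm_jet_le (hs : 5 / 2 < s) : ∃ C : ℝ, 0 ≤ C ∧ ∀ (j : ℕ) (f : Sobolev s), j ≤ 2 →
    ‖f.jet j‖ ≤ C * ‖f‖ := by
  obtain ⟨C, hC0, hC⟩ := summable_sq_bracket_mul_norm hs
  exact ⟨C, hC0, fun j f hj =>
    (norm_synth_le (hC f).1.hasSum (norm_jet_coeff_le hj f)).trans (hC f).2⟩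

theorem continuous_jet (hs : 5 / 2 < s) {j : ℕ} (hj : j ≤ 2) :
    Continuous fun f : Sobolev s => f.jet j := by
  obtain ⟨C, hC0, hC⟩ := norm_jet_le hs
  refine (LipschitzWith.of_dist_le_mul (K := ⟨C, hC0⟩) fun f g => ?_).continuous
  rw [dist_eq_norm, dist_eq_norm, jet_sub hs hj]
  exact hC j _ hj

theorem continuous_fourierCoeff_sobolev (hs : 5 / 2 < s) (k : ℤ) :
    Continuous fun f : Sobolev s => fourierCoeff f k := by
  have h : ∀ f : Sobolev s, fourierCoeff f k = coeffCLM k (f.jet 0) := fun f => by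
    rw [coeffCLM_apply, fourierCoeff_jet hs (by norm_num), pow_zero, one_mul]
  simp_rw [h]
  exact (coeffCLM k).continuous.comp (continuous_jet hs (by norm_num))

theorem ae_eq_jet_zero (hs : 5 / 2 < s) (f : Sobolev s) : (f : Torus → ℂ) =ᵐ[μT] f.jet 0 := by
  have h : f.toL2 = ContinuousMap.toLp (E := ℂ) 2 μT ℂ (f.jet 0) := by
    refine fourierBasis.repr.injective (lp.ext (funext fun k => ?_))
    rw [fourierBasis_repr, fourierBasis_repr, fourierCoeff_toLp,
      fourierCoeff_jet hs (by norm_num), pow_zero, one_mul]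
  change (f.toL2 : Torus → ℂ) =ᵐ[μT] _
  rw [h]
  exact ContinuousMap.coeFn_toLp μT (f.jet 0)

theorem dx_eq_jet_one (hs : 5 / 2 < s) (f : Sobolev s) : dx f = f.jet 1 := by
  ext x
  have hc := summable_jet_coeff hs (j := 1) (by norm_num) f
  rw [Sobolev.jet, synth_apply hc]
  simp only [dx, fourierMultiplier, pow_one]

/-! ### The nonlinearity and its derivative -/

/-- The arguments `(u, ∂ₓu, ū, conj ∂ₓu)` of the nonlinearity. -/
noncomputable def Sobolev.args (f : Sobolev s) : Fin 4 → C(Torus, ℂ) :=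
  ![f.jet 0, f.jet 1, star (f.jet 0), star (f.jet 1)]

/-- The derivatives of the arguments `(u, ∂ₓu, ū, conj ∂ₓu)`. -/
noncomputable def Sobolev.args' (f : Sobolev s) : Fin 4 → C(Torus, ℂ) :=
  ![f.jet 1, f.jet 2, star (f.jet 1), star (f.jet 2)]

/-- `F(u, ∂ₓu, ū, conj ∂ₓu)` as a continuous function. -/
noncomputable def Sobolev.poly (F : MvPolynomial (Fin 4) ℂ) (f : Sobolev s) : C(Torus, ℂ) :=
  MvPolynomial.aeval f.args F

theorem poly_apply (F : MvPolynomial (Fin 4) ℂ) (f : Sobolev s) (x : Torus) :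
    f.poly F x = nonlin F (f.jet 0 x) (f.jet 1 x) := by
  rw [Sobolev.poly, nonlin]
  induction F using MvPolynomial.induction_on with
  | C a => simp
  | add p q hp hq => rw [map_add, map_add, ContinuousMap.add_apply, hp, hq]
  | mul_X p j hp =>
    rw [map_mul, map_mul, ContinuousMap.mul_apply, hp, MvPolynomial.aeval_X, MvPolynomial.eval_X]
    congr 1
    fin_cases j <;> rfl

theorem nonlin_ae_eq_poly (hs : 5 / 2 < s) (F : MvPolynomial (Fin 4) ℂ) (f : Sobolev s) :
    (fun x => nonlin F (f x) (dx f x)) =ᵐ[μT] f.poly F := by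
  filter_upwards [ae_eq_jet_zero hs f] with x hx
  rw [poly_apply, hx, dx_eq_jet_one hs]

theorem hasDerivAt_eval_mvPolynomial {n : Type*} [Fintype n] [DecidableEq n] {y : ℝ → n → ℂ}
    {y' : n → ℂ} {t : ℝ} (hy : ∀ j, HasDerivAt (fun τ => y τ j) (y' j) t) (F : MvPolynomial n ℂ) :
    HasDerivAt (fun τ => MvPolynomial.eval (y τ) F)
      (∑ j, MvPolynomial.eval (y t) (MvPolynomial.pderiv j F) * y' j) t := by
  induction F using MvPolynomial.induction_on with
  | C a => simpa using hasDerivAt_const t a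
  | add p q hp hq =>
    simp only [map_add, add_mul, Finset.sum_add_distrib]
    exact hp.add hq
  | mul_X p j hp =>
    have h := hp.mul (hy j)
    have e : ∑ i, MvPolynomial.eval (y t) (MvPolynomial.pderiv i (p * MvPolynomial.X j)) * y' i
        = (∑ i, MvPolynomial.eval (y t) (MvPolynomial.pderiv i p) * y' i) * y t j
          + MvPolynomial.eval (y t) p * y' j := by
      have e3 : ∀ i, MvPolynomial.eval (y t) (MvPolynomial.pderiv i (p * MvPolynomial.X j)) * y' i
          = (MvPolynomial.eval (y t) (MvPolynomial.pderiv i p) * y' i) * y t j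
            + if i = j then MvPolynomial.eval (y t) p * y' j else 0 := by
        intro i
        rw [Derivation.leibniz, smul_eq_mul, smul_eq_mul, map_add, map_mul, map_mul,
          MvPolynomial.eval_X, MvPolynomial.pderiv_X]
        split_ifs with h
        · subst h
          rw [Pi.single_eq_same, map_one]
          ring
        · rw [Pi.single_eq_of_ne (Ne.symm h), map_zero]
          ring
      rw [Finset.sum_congr rfl fun i _ => e3 i, Finset.sum_add_distrib, ← Finset.sum_mul,
        Finset.sum_ite_eq' Finset.univ j, if_pos (Finset.mem_univ j)]
    rw [e]
    simp only [map_mul, MvPolynomial.eval_X]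
    exact h

/-- The Wirtinger derivative in the variable `ω` is the formal derivative of the polynomial in the
second variable: in `½ (∂_a - i ∂_b)` the contributions of `ω̄` cancel. -/
theorem nonlinDw_eq (F : MvPolynomial (Fin 4) ℂ) (ζ w : ℂ) :
    nonlinDw F ζ w = nonlin (MvPolynomial.pderiv 1 F) ζ w := by
  have key : ∀ d : ℂ, deriv (fun a : ℝ => nonlin F ζ (w + a * d)) 0
      = nonlin (MvPolynomial.pderiv 1 F) ζ w * d
        + nonlin (MvPolynomial.pderiv 3 F) ζ w * conj d := by
    intro d
    have h1 : HasDerivAt (fun a : ℝ => w + a * d) d 0 := by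
      simpa using ((hasDerivAt_id (0 : ℝ)).ofReal_comp.mul_const d).const_add w
    have h2 : HasDerivAt (fun a : ℝ => conj (w + a * d)) (conj d) 0 := by
      have : (fun a : ℝ => conj (w + a * d)) = fun a : ℝ => conj w + a * conj d := by
        ext a
        simp
      rw [this]
      simpa using ((hasDerivAt_id (0 : ℝ)).ofReal_comp.mul_const (conj d)).const_add (conj w)
    have := hasDerivAt_eval_mvPolynomial
      (y := fun a : ℝ => ![ζ, w + a * d, conj ζ, conj (w + a * d)]) (y' := ![0, d, 0, conj d])
      (t := 0) (fun j => by
        fin_cases j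
        · exact hasDerivAt_const _ _
        · exact h1
        · exact hasDerivAt_const _ _
        · exact h2) F
    have h3 := this.deriv
    simp only [nonlin]
    rw [h3, Fin.sum_univ_four]
    simp
  have k1 := key 1
  have k2 := key Complex.I
  simp only [mul_one, map_one, Complex.conj_I] at k1 k2
  rw [nonlinDw, k1, k2]
  linear_combination (-1 / 2 * nonlin (MvPolynomial.pderiv 1 F) ζ w
    + 1 / 2 * nonlin (MvPolynomial.pderiv 3 F) ζ w) * Complex.I_sq

/-- The mean of `Im F_ω` is the imaginary part of the zeroth Fourier coefficient of `F_ω`. -/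
theorem integral_im_nonlinDw (hs : 5 / 2 < s) (F : MvPolynomial (Fin 4) ℂ) (f : Sobolev s) :
    ∫ x, (nonlinDw F (f x) (dx f x)).im ∂μT
      = (fourierCoeff (f.poly (MvPolynomial.pderiv 1 F)) 0).im := by
  have h1 : ∫ x, (nonlinDw F (f x) (dx f x)).im ∂μT
      = ∫ x, (f.poly (MvPolynomial.pderiv 1 F) x).im ∂μT := by
    refine integral_congr_ae ?_
    filter_upwards [nonlin_ae_eq_poly hs (MvPolynomial.pderiv 1 F) f] with x hx
    rw [nonlinDw_eq, hx]
  have h2 : fourierCoeff (f.poly (MvPolynomial.pderiv 1 F)) 0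
      = ∫ x, f.poly (MvPolynomial.pderiv 1 F) x ∂μT := by
    simp [fourierCoeff]
  rw [h1, h2]
  exact integral_im (integrable_continuousMap _)

theorem continuous_args (hs : 5 / 2 < s) (j : Fin 4) :
    Continuous fun f : Sobolev s => f.args j := by
  have h0 := continuous_jet hs (j := 0) (by norm_num)
  have h1 := continuous_jet hs (j := 1) (by norm_num)
  fin_cases j
  · exact h0
  · exact h1
  · exact continuous_star.comp h0
  · exact continuous_star.comp h1

theorem continuous_poly (hs : 5 / 2 < s) (F : MvPolynomial (Fin 4) ℂ) :
    Continuous fun f : Sobolev s => f.poly F := by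
  simp only [Sobolev.poly]
  induction F using MvPolynomial.induction_on with
  | C a => simpa using continuous_const
  | add p q hp hq =>
    simp only [map_add]
    exact hp.add hq
  | mul_X p j hp =>
    simp only [map_mul, MvPolynomial.aeval_X]
    exact hp.mul (continuous_args hs j)

theorem fourierCoeff_args' (hs : 5 / 2 < s) (f : Sobolev s) (j : Fin 4) (k : ℤ) :
    fourierCoeff (f.args' j) k = Complex.I * k * fourierCoeff (f.args j) k := by
  have h : ∀ i : ℕ, i ≤ 1 → ∀ k : ℤ, fourierCoeff (f.jet (i + 1)) k
      = Complex.I * k * fourierCoeff (f.jet i) k := fun i hi k => by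
    rw [fourierCoeff_jet hs (by omega), fourierCoeff_jet hs (by omega), pow_succ]
    ring
  have h' : ∀ i : ℕ, i ≤ 1 → ∀ k : ℤ, fourierCoeff (star (f.jet (i + 1)) : C(Torus, ℂ)) k
      = Complex.I * k * fourierCoeff (star (f.jet i) : C(Torus, ℂ)) k := fun i hi k => by
    rw [fourierCoeff_star, fourierCoeff_star, h i hi, map_mul, map_mul, Complex.conj_I]
    push_cast
    rw [map_neg, map_intCast]
    ring
  fin_cases j
  · exact h 0 (by norm_num) k
  · exact h 1 (by norm_num) k
  · exact h' 0 (by norm_num) k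
  · exact h' 1 (by norm_num) k

variable {ι : Type*} {w : ι → Sobolev s}

theorem uniformDecay_jet (hs : 5 / 2 < s) {K : ℝ} (hK : ∀ i, ‖w i‖ ≤ K) (hK0 : 0 ≤ K) {j : ℕ}
    (hj : j ≤ 2) : UniformDecay (s - j) fun i => (w i).jet j :=
  ⟨K, hK0, fun i k => (norm_fourierCoeff_jet_le hs hj (w i) k).trans
    (mul_le_mul_of_nonneg_right (hK i) (Real.rpow_nonneg (bracket_pos k).le _))⟩

theorem uniformDecay_poly (hs : 5 / 2 < s) {K : ℝ} (hK : ∀ i, ‖w i‖ ≤ K) (hK0 : 0 ≤ K)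
    (F : MvPolynomial (Fin 4) ℂ) : UniformDecay (s - 1) fun i => (w i).poly F := by
  have h0 : UniformDecay (s - 1) fun i => (w i).jet 0 :=
    (uniformDecay_jet hs hK hK0 (j := 0) (by norm_num)).mono (by simp)
  have h1 : UniformDecay (s - 1) fun i => (w i).jet 1 := by
    simpa using uniformDecay_jet hs hK hK0 (j := 1) (by norm_num)
  refine UniformDecay.aeval (by linarith) (fun j => ?_) F
  fin_cases j
  · exact h0
  · exact h1
  · exact h0.star
  · exact h1.star

end

/-! ### From the weak formulation to Duhamel's formula for each Fourier mode -/

/-- The test function `θ(t) e^{-ikx}`. -/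
noncomputable def modeTest (θ : ℝ → ℝ) (k : ℤ) (t : ℝ) (x : Torus) : ℂ := (θ t : ℂ) * fourier (-k) x

theorem isSmooth_modeTest {θ : ℝ → ℝ} (hθ : ContDiff ℝ ∞ θ) (k : ℤ) : IsSmooth (modeTest θ k) := by
  simp only [IsSmooth, modeTest, fourier_coe_apply]
  have h1 : ContDiff ℝ ∞ fun p : ℝ × ℝ => (θ p.1 : ℂ) :=
    Complex.ofRealCLM.contDiff.comp (hθ.comp contDiff_fst)
  have h2 : ContDiff ℝ ∞ fun p : ℝ × ℝ => (p.2 : ℂ) := Complex.ofRealCLM.contDiff.comp contDiff_snd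
  refine h1.mul (ContDiff.cexp ?_)
  exact (contDiff_const.mul h2).div_const _

theorem integral_mul_mode (f : Torus → ℂ) (c : ℂ) (k : ℤ) :
    ∫ x, f x * (c * fourier (-k) x) ∂μT = c * fourierCoeff f k := by
  rw [fourierCoeff, ← integral_const_mul]
  refine integral_congr_ae (Eventually.of_forall fun x => ?_)
  simp only [smul_eq_mul]
  ring

theorem deriv_modeTest {θ : ℝ → ℝ} (hθ : ContDiff ℝ ∞ θ) (k : ℤ) (t : ℝ) (x : Torus) :
    deriv (fun τ => modeTest θ k τ x) t = ((deriv θ t : ℝ) : ℂ) * fourier (-k) x := by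
  have h : HasDerivAt θ (deriv θ t) t := (hθ.differentiable (by simp) t).hasDerivAt
  exact (h.ofReal_comp.mul_const _).deriv

theorem fracD_modeTest (α : ℝ) (θ : ℝ → ℝ) (k : ℤ) (t : ℝ) (x : Torus) :
    fracD α (modeTest θ k t) x = ((θ t : ℂ) * ((|(k : ℝ)| ^ α : ℝ) : ℂ)) * fourier (-k) x := by
  have hc : ∀ j : ℤ, fourierCoeff (modeTest θ k t) j
      = (θ t : ℂ) * Pi.single (M := fun _ : ℤ => ℂ) (-k) 1 j := by
    intro j
    rw [← fourierCoeff_fourier (T := 2 * Real.pi)]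
    exact fourierCoeff.const_mul _ _ _
  rw [fracD, fourierMultiplier, tsum_eq_single (-k)]
  · rw [hc, Pi.single_eq_same]
    push_cast
    rw [abs_neg]
    ring
  · intro j hj
    rw [hc, Pi.single_eq_of_ne hj]
    ring

section

variable {s : ℝ}

/-- Tested against `θ(t) e^{-ikx}`, every term of the weak formulation becomes a Fourier mode. -/
theorem pairing_modeTest (hs : 5 / 2 < s) (α : ℝ) (F : MvPolynomial (Fin 4) ℂ) {θ : ℝ → ℝ}
    (hθ : ContDiff ℝ ∞ θ) (k : ℤ) (f : Sobolev s) (t : ℝ) :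
    (∫ x, f x * deriv (fun τ => modeTest θ k τ x) t ∂μT = ((deriv θ t : ℝ) : ℂ) * fourierCoeff f k) ∧
    (∫ x, f x * modeTest θ k t x ∂μT = (θ t : ℂ) * fourierCoeff f k) ∧
    (∫ x, f x * fracD α (modeTest θ k t) x ∂μT
      = (θ t : ℂ) * (((|(k : ℝ)| ^ α : ℝ) : ℂ) * fourierCoeff f k)) ∧
    (∫ x, nonlin F (f x) (dx f x) * modeTest θ k t x ∂μT = (θ t : ℂ) * fourierCoeff (f.poly F) k) := by
  refine ⟨?_, integral_mul_mode _ _ _, ?_, ?_⟩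
  · simp_rw [deriv_modeTest hθ]
    exact integral_mul_mode _ _ _
  · simp_rw [fracD_modeTest]
    rw [integral_mul_mode, mul_assoc]
  · rw [← fourierCoeff_congr_ae (nonlin_ae_eq_poly hs F f)]
    exact integral_mul_mode _ _ _

/-- The `k`-th Fourier mode `-i|k|^α û(k) + F(u, …)^(k)` of `∂ₜu`, as a function of `u`. -/
noncomputable def modeRHS (α : ℝ) (F : MvPolynomial (Fin 4) ℂ) (k : ℤ) (f : Sobolev s) : ℂ :=
  -Complex.I * ((|(k : ℝ)| ^ α : ℝ) : ℂ) * fourierCoeff f k + fourierCoeff (f.poly F) k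

theorem continuous_modeRHS (hs : 5 / 2 < s) (α : ℝ) (F : MvPolynomial (Fin 4) ℂ) (k : ℤ) :
    Continuous fun f : Sobolev s => modeRHS α F k f := by
  have h1 := continuous_fourierCoeff_sobolev hs k
  have h2 : Continuous fun f : Sobolev s => coeffCLM k (f.poly F) :=
    (coeffCLM k).continuous.comp (continuous_poly hs F)
  exact (continuous_const.mul h1).add h2

theorem integral_mul_modeRHS (hs : 5 / 2 < s) (α : ℝ) (F : MvPolynomial (Fin 4) ℂ) (k : ℤ)
    {w : ℝ → Sobolev s} (hw : Continuous w) {θ : ℝ → ℝ} (hθ : Continuous θ) (σ T : ℝ) :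
    ∫ t in (0)..T, (θ t : ℂ) * ((σ : ℂ) * modeRHS α F k (w t))
      = (σ : ℂ) * ((∫ t in (0)..T, (θ t : ℂ) * fourierCoeff ((w t).poly F) k)
        - Complex.I * ∫ t in (0)..T,
          (θ t : ℂ) * (((|(k : ℝ)| ^ α : ℝ) : ℂ) * fourierCoeff (w t) k)) := by
  have hθc : Continuous fun t => (θ t : ℂ) := Complex.continuous_ofReal.comp hθ
  have hN : Continuous fun t => fourierCoeff ((w t).poly F) k :=
    (coeffCLM k).continuous.comp ((continuous_poly hs F).comp hw)
  have hco : Continuous fun t => fourierCoeff (w t) k :=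
    (continuous_fourierCoeff_sobolev hs k).comp hw
  have c1 : Continuous fun t => (θ t : ℂ) * fourierCoeff ((w t).poly F) k := hθc.mul hN
  have c2 : Continuous fun t =>
      Complex.I * ((θ t : ℂ) * (((|(k : ℝ)| ^ α : ℝ) : ℂ) * fourierCoeff (w t) k)) :=
    continuous_const.mul (hθc.mul (continuous_const.mul hco))
  have h := intervalIntegral.integral_sub (μ := volume) (c1.intervalIntegrable 0 T)
    (c2.intervalIntegrable 0 T)
  rw [← intervalIntegral.integral_const_mul, ← h, ← intervalIntegral.integral_const_mul]
  refine intervalIntegral.integral_congr fun t _ => ?_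
  simp only [modeRHS]
  ring

/-- A curve in `H^s` whose Fourier modes satisfy the equation, run forward (`σ = 1`) or backward
(`σ = -1`) in time, on `[0,T]`. The curve is defined, continuous and bounded on the whole line, while
the equation is imposed on `[0,T]` only. -/
structure ModeSolution (α : ℝ) (F : MvPolynomial (Fin 4) ℂ) (φ : Sobolev s) (T σ : ℝ)
    (w : ℝ → Sobolev s) : Prop where
  continuous : Continuous w
  bounded : ∃ K, 0 ≤ K ∧ ∀ t, ‖w t‖ ≤ K
  eq : ∀ k : ℤ, ∀ t ∈ Icc 0 T,
    fourierCoeff (w t) k = fourierCoeff φ k + ∫ τ in (0)..t, (σ : ℂ) * modeRHS α F k (w τ)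

/-- A curve on `[0,T]`, extended by constants, is continuous and bounded on the line. -/
theorem exists_norm_le_comp_projIcc {T : ℝ} (hT : 0 ≤ T) {v : ℝ → Sobolev s}
    (hv : ContinuousOn v (Icc 0 T)) :
    Continuous (fun t => v (projIcc 0 T hT t)) ∧
      ∃ K, 0 ≤ K ∧ ∀ t, ‖v (projIcc 0 T hT t)‖ ≤ K := by
  refine ⟨hv.comp_continuous (continuous_subtype_val.comp continuous_projIcc)
    fun t => (projIcc 0 T hT t).2, ?_⟩
  obtain ⟨K, hK⟩ := isCompact_Icc.exists_bound_of_continuousOn hv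
  exact ⟨K, (norm_nonneg _).trans (hK 0 ⟨le_rfl, hT⟩), fun t => hK _ (projIcc 0 T hT t).2⟩

theorem IsSolutionForward.modeSolution (hs : 5 / 2 < s) {α T : ℝ} (hT : 0 < T)
    {F : MvPolynomial (Fin 4) ℂ} {φ : Sobolev s} {u : ℝ → Sobolev s}
    (hu : ContinuousOn u (Icc 0 T)) (hsol : IsSolutionForward α F φ T u) :
    ModeSolution α F φ T 1 fun t => u (projIcc 0 T hT.le t) := by
  obtain ⟨hwc, hwb⟩ := exists_norm_le_comp_projIcc hT.le hu
  set w : ℝ → Sobolev s := fun t => u (projIcc 0 T hT.le t) with hw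
  have hwu : ∀ t ∈ uIcc 0 T, u t = w t := fun t ht => by
    rw [uIcc_of_le hT.le] at ht
    rw [hw]
    simp only [projIcc_of_mem hT.le ht]
  refine ⟨hwc, hwb, fun k => ?_⟩
  have hmode := (continuous_modeRHS hs α F k).comp hwc
  have hco := (continuous_fourierCoeff_sobolev hs k).comp hwc
  refine eq_add_integral_of_weak hT hco (continuous_const.mul hmode) fun θ hθ hθT => ?_
  obtain ⟨T', hT', hz⟩ := hθT
  have h := hsol.2 (modeTest θ k) ⟨isSmooth_modeTest hθ k, T', hT', fun t ht x => by
    simp [modeTest, hz t ht]⟩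
  have e1 : (∫ t in (0)..T, ∫ x, u t x * deriv (fun τ => modeTest θ k τ x) t ∂μT)
      = ∫ t in (0)..T, ((deriv θ t : ℝ) : ℂ) * fourierCoeff (w t) k :=
    intervalIntegral.integral_congr fun t ht => by
      simp only [hwu t ht]; exact (pairing_modeTest hs α F hθ k (w t) t).1
  have e2 : (∫ t in (0)..T, ∫ x, u t x * fracD α (modeTest θ k t) x ∂μT)
      = ∫ t in (0)..T, (θ t : ℂ) * (((|(k : ℝ)| ^ α : ℝ) : ℂ) * fourierCoeff (w t) k) :=
    intervalIntegral.integral_congr fun t ht => by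
      simp only [hwu t ht]; exact (pairing_modeTest hs α F hθ k (w t) t).2.2.1
  have e3 : (∫ t in (0)..T, ∫ x, nonlin F (u t x) (dx (u t) x) * modeTest θ k t x ∂μT)
      = ∫ t in (0)..T, (θ t : ℂ) * fourierCoeff ((w t).poly F) k :=
    intervalIntegral.integral_congr fun t ht => by
      simp only [hwu t ht]; exact (pairing_modeTest hs α F hθ k (w t) t).2.2.2
  rw [e1, e2, e3, (pairing_modeTest hs α F hθ k φ 0).2.1] at h
  change _ = ∫ t in (0)..T, (θ t : ℂ) * (((1 : ℝ) : ℂ) * modeRHS α F k (w t))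
  rw [integral_mul_modeRHS hs α F k hwc hθ.continuous]
  push_cast
  linear_combination h

theorem IsSolutionBackward.modeSolution (hs : 5 / 2 < s) {α T : ℝ} (hT : 0 < T)
    {F : MvPolynomial (Fin 4) ℂ} {φ : Sobolev s} {u : ℝ → Sobolev s}
    (hu : ContinuousOn u (Icc (-T) 0)) (hsol : IsSolutionBackward α F φ T u) :
    ModeSolution α F φ T (-1) fun t => u (-(projIcc 0 T hT.le t : ℝ)) := by
  have hu' : ContinuousOn (fun t => u (-t)) (Icc 0 T) :=
    hu.comp continuous_neg.continuousOn fun t ht => ⟨by linarith [ht.2], by linarith [ht.1]⟩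
  obtain ⟨hwc, hwb⟩ := exists_norm_le_comp_projIcc hT.le hu'
  set w : ℝ → Sobolev s := fun t => u (-(projIcc 0 T hT.le t : ℝ)) with hw
  have hwu : ∀ t ∈ uIcc 0 T, u (-t) = w t := fun t ht => by
    rw [uIcc_of_le hT.le] at ht
    rw [hw]
    simp only [projIcc_of_mem hT.le ht]
  refine ⟨hwc, hwb, fun k => ?_⟩
  have hmode := (continuous_modeRHS hs α F k).comp hwc
  have hco := (continuous_fourierCoeff_sobolev hs k).comp hwc
  refine eq_add_integral_of_weak hT hco (continuous_const.mul hmode) fun θ hθ hθT => ?_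
  obtain ⟨T', hT', hz⟩ := hθT
  -- test functions for the reversed equation are reflected to the past
  set ϑ : ℝ → ℝ := fun t => θ (-t) with hϑ
  have hϑs : ContDiff ℝ ∞ ϑ := hθ.comp contDiff_neg
  have hϑd : ∀ t, deriv ϑ (-t) = -deriv θ t := fun t => by
    rw [hϑ, deriv_comp_neg, neg_neg]
  have hϑn : ∀ t, ϑ (-t) = θ t := fun t => by simp [hϑ]
  have h := hsol.2 (modeTest ϑ k) ⟨isSmooth_modeTest hϑs k, T', hT', fun t ht x => by
    simp [modeTest, hϑ, hz (-t) (by linarith)]⟩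
  have hrev : ∀ g : ℝ → ℂ, ∫ t in (-T)..0, g t = ∫ t in (0)..T, g (-t) := fun g => by
    simp
  rw [hrev, hrev, hrev] at h
  have e1 : (∫ t in (0)..T, ∫ x, u (-t) x * deriv (fun τ => modeTest ϑ k τ x) (-t) ∂μT)
      = -∫ t in (0)..T, ((deriv θ t : ℝ) : ℂ) * fourierCoeff (w t) k := by
    rw [← intervalIntegral.integral_neg]
    refine intervalIntegral.integral_congr fun t ht => ?_
    simp only [hwu t ht]
    rw [(pairing_modeTest hs α F hϑs k (w t) (-t)).1, hϑd]
    push_cast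
    ring
  have e2 : (∫ t in (0)..T, ∫ x, u (-t) x * fracD α (modeTest ϑ k (-t)) x ∂μT)
      = ∫ t in (0)..T, (θ t : ℂ) * (((|(k : ℝ)| ^ α : ℝ) : ℂ) * fourierCoeff (w t) k) :=
    intervalIntegral.integral_congr fun t ht => by
      simp only [hwu t ht]
      rw [(pairing_modeTest hs α F hϑs k (w t) (-t)).2.2.1, hϑn]
  have e3 : (∫ t in (0)..T, ∫ x, nonlin F (u (-t) x) (dx (u (-t)) x) * modeTest ϑ k (-t) x ∂μT)
      = ∫ t in (0)..T, (θ t : ℂ) * fourierCoeff ((w t).poly F) k :=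
    intervalIntegral.integral_congr fun t ht => by
      simp only [hwu t ht]
      rw [(pairing_modeTest hs α F hϑs k (w t) (-t)).2.2.2, hϑn]
  have h0 : ϑ 0 = θ 0 := by simp [hϑ]
  rw [e1, e2, e3, (pairing_modeTest hs α F hϑs k φ 0).2.1, h0] at h
  change _ = ∫ t in (0)..T, (θ t : ℂ) * (((-1 : ℝ) : ℂ) * modeRHS α F k (w t))
  rw [integral_mul_modeRHS hs α F k hwc hθ.continuous]
  push_cast
  linear_combination -h

end

/-! ### Hölder regularity in time -/

/-- `f` is bounded and Hölder continuous of order `θ` on `S`, for the supremum norm of `C(𝕋)`. -/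
def BoundedHolder (S : Set ℝ) (θ : ℝ) (f : ℝ → C(Torus, ℂ)) : Prop :=
  ∃ K : ℝ, 0 ≤ K ∧ (∀ t ∈ S, ‖f t‖ ≤ K) ∧ ∀ t ∈ S, ∀ t' ∈ S, ‖f t - f t'‖ ≤ K * |t - t'| ^ θ

section

variable {S : Set ℝ} {θ : ℝ} {f g : ℝ → C(Torus, ℂ)}

theorem BoundedHolder.add (hf : BoundedHolder S θ f) (hg : BoundedHolder S θ g) :
    BoundedHolder S θ fun t => f t + g t := by
  obtain ⟨K, hK0, hK, hK'⟩ := hf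
  obtain ⟨L, hL0, hL, hL'⟩ := hg
  refine ⟨K + L, by positivity, fun t ht => norm_add_le_of_le (hK t ht) (hL t ht),
    fun t ht t' ht' => ?_⟩
  rw [add_sub_add_comm, add_mul]
  exact norm_add_le_of_le (hK' t ht t' ht') (hL' t ht t' ht')

theorem BoundedHolder.mul (hf : BoundedHolder S θ f) (hg : BoundedHolder S θ g) :
    BoundedHolder S θ fun t => f t * g t := by
  obtain ⟨K, hK0, hK, hK'⟩ := hf
  obtain ⟨L, hL0, hL, hL'⟩ := hg
  refine ⟨2 * (K * L), by positivity, fun t ht => ?_, fun t ht t' ht' => ?_⟩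
  · have : ‖f t * g t‖ ≤ K * L := (norm_mul_le _ _).trans
      (mul_le_mul (hK t ht) (hL t ht) (norm_nonneg _) hK0)
    nlinarith [mul_nonneg hK0 hL0]
  · have e : f t * g t - f t' * g t' = (f t - f t') * g t + f t' * (g t - g t') := by ring
    rw [e]
    have h1 : ‖(f t - f t') * g t‖ ≤ (K * |t - t'| ^ θ) * L := (norm_mul_le _ _).trans
      (mul_le_mul (hK' t ht t' ht') (hL t ht) (norm_nonneg _) (by positivity))
    have h2 : ‖f t' * (g t - g t')‖ ≤ K * (L * |t - t'| ^ θ) := (norm_mul_le _ _).trans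
      (mul_le_mul (hK t' ht') (hL' t ht t' ht') (norm_nonneg _) hK0)
    refine (norm_add_le_of_le h1 h2).trans (le_of_eq (by ring))

theorem BoundedHolder.star (hf : BoundedHolder S θ f) : BoundedHolder S θ fun t => star (f t) := by
  obtain ⟨K, hK0, hK, hK'⟩ := hf
  refine ⟨K, hK0, fun t ht => by rw [norm_star]; exact hK t ht, fun t ht t' ht' => ?_⟩
  rw [← star_sub, norm_star]
  exact hK' t ht t' ht'

theorem BoundedHolder.aeval {X : ℝ → Fin 4 → C(Torus, ℂ)}
    (hX : ∀ j, BoundedHolder S θ fun t => X t j) (F : MvPolynomial (Fin 4) ℂ) :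
    BoundedHolder S θ fun t => MvPolynomial.aeval (X t) F := by
  induction F using MvPolynomial.induction_on with
  | C a =>
    refine ⟨‖algebraMap ℂ C(Torus, ℂ) a‖, norm_nonneg _, fun t _ => ?_, fun t _ t' _ => ?_⟩
    · simp only [MvPolynomial.aeval_C, le_refl]
    · simp only [MvPolynomial.aeval_C, sub_self, norm_zero]
      positivity
  | add p q hp hq =>
    simp only [map_add]
    exact hp.add hq
  | mul_X p j hp =>
    simp only [map_mul, MvPolynomial.aeval_X]
    exact hp.mul (hX j)

theorem min_one_le_rpow {x θ : ℝ} (hx : 0 ≤ x) (h0 : 0 ≤ θ) (h1 : θ ≤ 1) : min 1 x ≤ x ^ θ := by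
  rcases le_total 1 x with h | h
  · rw [min_eq_left h]
    exact Real.one_le_rpow h h0
  · rw [min_eq_right h]
    calc x = x ^ (1 : ℝ) := (Real.rpow_one x).symm
      _ ≤ x ^ θ := by
        rcases hx.eq_or_lt with rfl | hx'
        · rw [Real.zero_rpow one_ne_zero]; positivity
        · exact Real.rpow_le_rpow_of_exponent_ge hx' h h1

variable {s α T σ : ℝ} {F : MvPolynomial (Fin 4) ℂ} {φ : Sobolev s} {w : ℝ → Sobolev s}

theorem ModeSolution.norm_nonlinearity_le (hs : 5 / 2 < s) (h : ModeSolution α F φ T σ w) :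
    ∃ K, 0 ≤ K ∧ ∀ t k, ‖fourierCoeff ((w t).poly F) k‖ ≤ K * bracket k ^ (-(s - 1)) := by
  obtain ⟨K, hK0, hK⟩ := h.bounded
  exact uniformDecay_poly hs hK hK0 F

theorem continuous_modeRHS_comp (hs : 5 / 2 < s) (h : ModeSolution α F φ T σ w) (k : ℤ) :
    Continuous fun τ => (σ : ℂ) * modeRHS α F k (w τ) :=
  continuous_const.mul ((continuous_modeRHS hs α F k).comp h.continuous)

/-- In time, a mode is bounded by the `H^s` norm and Lipschitz continuous by the equation. -/
theorem ModeSolution.norm_sub_le (hs : 5 / 2 < s) (hα : 1 ≤ α) (hσ : |σ| = 1)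
    (h : ModeSolution α F φ T σ w) :
    ∃ L, 0 ≤ L ∧ ∀ k, ∀ t ∈ Icc 0 T, ∀ t' ∈ Icc 0 T,
      ‖fourierCoeff (w t) k - fourierCoeff (w t') k‖
        ≤ L * bracket k ^ (-s) * min 1 (|t - t'| * bracket k ^ α) := by
  obtain ⟨K, hK0, hK⟩ := h.bounded
  obtain ⟨N, hN0, hN⟩ := h.norm_nonlinearity_le hs
  have hc : ∀ t k, ‖fourierCoeff (w t) k‖ ≤ K * bracket k ^ (-s) := fun t k =>
    (norm_fourierCoeff_sobolev_le (w t) k).trans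
      (mul_le_mul_of_nonneg_right (hK t) (Real.rpow_nonneg (bracket_pos k).le _))
  refine ⟨2 * K + N, by positivity, fun k t ht t' ht' => ?_⟩
  have hb := bracket_pos k
  have hbs := Real.rpow_pos_of_pos hb (-s)
  have hrhs : ∀ τ, ‖(σ : ℂ) * modeRHS α F k (w τ)‖
      ≤ (2 * K + N) * bracket k ^ (-s) * bracket k ^ α := by
    intro τ
    rw [norm_mul, Complex.norm_real, Real.norm_eq_abs, hσ, one_mul, modeRHS]
    have h1 : ‖-Complex.I * ((|(k : ℝ)| ^ α : ℝ) : ℂ) * fourierCoeff (w τ) k‖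
        ≤ bracket k ^ α * (K * bracket k ^ (-s)) := by
      rw [norm_mul, norm_mul, norm_neg, Complex.norm_I, one_mul, Complex.norm_real,
        Real.norm_of_nonneg (by positivity)]
      have := Real.rpow_le_rpow (abs_nonneg (k : ℝ)) (abs_le_bracket k) (by linarith : 0 ≤ α)
      have h2 := hc τ k
      gcongr
    have h2 : ‖fourierCoeff ((w τ).poly F) k‖ ≤ N * (bracket k ^ (-s) * bracket k ^ α) := by
      refine (hN τ k).trans ?_
      gcongr
      rw [← Real.rpow_add hb]
      exact Real.rpow_le_rpow_of_exponent_le (one_le_bracket k) (by linarith)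
    refine (norm_add_le_of_le h1 h2).trans ?_
    have h3 : 0 ≤ K * (bracket k ^ (-s) * bracket k ^ α) := by positivity
    linarith
  have h1 : ‖fourierCoeff (w t) k - fourierCoeff (w t') k‖ ≤ (2 * K + N) * bracket k ^ (-s) := by
    have h2 := norm_sub_le_of_le (hc t k) (hc t' k)
    have : 0 ≤ N * bracket k ^ (-s) := by positivity
    linarith
  have h2 : ‖fourierCoeff (w t) k - fourierCoeff (w t') k‖
      ≤ (2 * K + N) * bracket k ^ (-s) * (|t - t'| * bracket k ^ α) := by
    have hi : ∀ a b, IntervalIntegrable (fun τ => (σ : ℂ) * modeRHS α F k (w τ)) volume a b :=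
      fun a b => (continuous_modeRHS_comp hs h k).intervalIntegrable a b
    rw [h.eq k t ht, h.eq k t' ht', add_sub_add_left_eq_sub,
      intervalIntegral.integral_interval_sub_left (hi _ _) (hi _ _)]
    refine (intervalIntegral.norm_integral_le_of_norm_le_const fun τ _ => hrhs τ).trans
      (le_of_eq (by ring))
  rcases min_choice 1 (|t - t'| * bracket k ^ α) with h3 | h3 <;> rw [h3]
  · rwa [mul_one]
  · exact h2

/-- Interpolating between the bound in `H^s` and the equation, the solution and its first
derivative are Hölder continuous in time with values in `C(𝕋)`. The exponent `1/(4α)` costs a factor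
`⟨k⟩^{1/4}`, which the convergence of `∑ₖ ⟨k⟩^{-(s-1)}` can spare. -/
theorem ModeSolution.boundedHolder_jet (hs : 5 / 2 < s) (hα : 1 ≤ α) (hσ : |σ| = 1)
    (h : ModeSolution α F φ T σ w) {j : ℕ} (hj : j ≤ 1) :
    BoundedHolder (Icc 0 T) (1 / (4 * α)) fun t => (w t).jet j := by
  obtain ⟨K, hK0, hK⟩ := h.bounded
  obtain ⟨C, hC0, hC⟩ := norm_jet_le hs
  obtain ⟨L, hL0, hL⟩ := h.norm_sub_le hs hα hσ
  have hS := summable_bracket_rpow (r := s - 5 / 4) (by linarith)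
  have hS0 : 0 ≤ ∑' k : ℤ, bracket k ^ (-(s - 5 / 4)) :=
    tsum_nonneg fun k => (Real.rpow_pos_of_pos (bracket_pos k) _).le
  refine ⟨C * K + L * ∑' k : ℤ, bracket k ^ (-(s - 5 / 4)), by positivity,
    fun t _ => ?_, fun t ht t' ht' => ?_⟩
  · have := (hC j (w t) (by omega)).trans (mul_le_mul_of_nonneg_left (hK t) hC0)
    have : 0 ≤ L * ∑' k : ℤ, bracket k ^ (-(s - 5 / 4)) := by positivity
    linarith
  · have hb : ‖(w t).jet j - (w t').jet j‖
        ≤ L * |t - t'| ^ (1 / (4 * α)) * ∑' k : ℤ, bracket k ^ (-(s - 5 / 4)) := by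
      rw [jet_sub hs (by omega)]
      refine norm_synth_le (hS.hasSum.mul_left _) fun k => ?_
      rw [norm_mul, norm_I_mul_pow, fourierCoeff_sobolev_sub]
      have hbk := bracket_pos k
      have hα0 : 0 < α := by linarith
      have h1 : |(k : ℝ)| ^ j ≤ bracket k ^ (1 : ℝ) := by
        rw [Real.rpow_one]
        calc |(k : ℝ)| ^ j ≤ bracket k ^ j := by gcongr; exact abs_le_bracket k
          _ ≤ bracket k ^ 1 := pow_le_pow_right₀ (one_le_bracket k) hj
          _ = bracket k := pow_one _
      have h2 : min 1 (|t - t'| * bracket k ^ α)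
          ≤ |t - t'| ^ (1 / (4 * α)) * bracket k ^ (1 / 4 : ℝ) := by
        refine (min_one_le_rpow (θ := 1 / (4 * α)) (by positivity) (by positivity)
          ((div_le_one (by positivity)).2 (by linarith))).trans (le_of_eq ?_)
        have e : α * (1 / (4 * α)) = 1 / 4 := by field_simp
        rw [Real.mul_rpow (abs_nonneg _) (by positivity), ← Real.rpow_mul hbk.le, e]
      calc _ ≤ bracket k ^ (1 : ℝ) * (L * bracket k ^ (-s)
            * (|t - t'| ^ (1 / (4 * α)) * bracket k ^ (1 / 4 : ℝ))) := by
            have h3 := hL k t ht t' ht'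
            gcongr
            exact h3.trans (by gcongr)
        _ = L * |t - t'| ^ (1 / (4 * α))
            * (bracket k ^ (1 : ℝ) * bracket k ^ (-s) * bracket k ^ (1 / 4 : ℝ)) := by ring
        _ = _ := by
            rw [← Real.rpow_add hbk, ← Real.rpow_add hbk]
            congr 2
            ring
    refine hb.trans ?_
    have : 0 ≤ C * K * |t - t'| ^ (1 / (4 * α)) := by positivity
    linarith

theorem ModeSolution.boundedHolder_poly (hs : 5 / 2 < s) (hα : 1 ≤ α) (hσ : |σ| = 1)
    (h : ModeSolution α F φ T σ w) (P : MvPolynomial (Fin 4) ℂ) :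
    BoundedHolder (Icc 0 T) (1 / (4 * α)) fun t => (w t).poly P := by
  have h0 := h.boundedHolder_jet hs hα hσ (j := 0) (by norm_num)
  have h1 := h.boundedHolder_jet hs hα hσ (j := 1) (by norm_num)
  refine BoundedHolder.aeval (fun j => ?_) P
  fin_cases j
  · exact h0
  · exact h1
  · exact h0.star
  · exact h1.star

/-! ### The principal part of the nonlinearity -/

/-- `ik` times the `k`-th mode of the nonlinearity is, up to terms that are negligible for large
`|k|`, a finite sum over the low frequencies `m` of the coefficients `F_ω` and `F_ω̄`, which multiply
the second derivatives. The terms with the first derivatives of `u` belong to the error. -/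
theorem ModeSolution.norm_nonlinearity_sub_sum_le (hs : 5 / 2 < s)
    (h : ModeSolution α F φ T σ w) :
    ∃ C, 0 ≤ C ∧ ∀ (t : ℝ) (k : ℤ) (M : ℕ),
      ‖Complex.I * k * fourierCoeff ((w t).poly F) k
        - ∑ m ∈ Finset.Icc (-(M : ℤ)) M,
          (fourierCoeff ((w t).poly (MvPolynomial.pderiv 1 F)) m * fourierCoeff ((w t).jet 2) (k - m)
          + fourierCoeff ((w t).poly (MvPolynomial.pderiv 3 F)) m
            * conj (fourierCoeff ((w t).jet 2) (m - k)))‖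
      ≤ C * (bracket k ^ (-(s - 2)) * (1 + M : ℝ) ^ (-(1 / 4) : ℝ) + bracket k ^ (-(s - 1))) := by
  obtain ⟨K, hK0, hK⟩ := h.bounded
  obtain ⟨C₀, hC₀, hC⟩ := norm_fourierCoeff_mul_sub_sum_le hs
  obtain ⟨C₂, hC₂, hsum⟩ := summable_sq_bracket_mul_norm (s := s) hs
  have hd1 : UniformDecay (s - 1) fun t => (w t).jet 1 := by
    simpa using uniformDecay_jet hs hK hK0 (j := 1) (by norm_num)
  obtain ⟨D₀, hD₀, hD0⟩ := (uniformDecay_poly hs hK hK0 (MvPolynomial.pderiv 0 F)).mul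
    (by linarith) hd1
  obtain ⟨D₂, hD₂, hD2⟩ := (uniformDecay_poly hs hK hK0 (MvPolynomial.pderiv 2 F)).mul
    (by linarith) hd1.star
  obtain ⟨G, hG0, hG⟩ := uniformDecay_poly hs hK hK0 (MvPolynomial.pderiv 1 F)
  obtain ⟨H, hH0, hH⟩ := uniformDecay_poly hs hK hK0 (MvPolynomial.pderiv 3 F)
  set L := K + C₂ * K with hL
  have hL0 : 0 ≤ L := by positivity
  have hW : ∀ t m, ‖fourierCoeff ((w t).jet 2) m‖ ≤ L * bracket m ^ (-(s - 2)) := fun t m => by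
    have h1 := norm_fourierCoeff_jet_le hs le_rfl (w t) m
    push_cast at h1
    refine h1.trans (mul_le_mul_of_nonneg_right ?_ (Real.rpow_nonneg (bracket_pos m).le _))
    have := hK t
    have : 0 ≤ C₂ * K := by positivity
    linarith
  have hWb : ∀ t m, ‖fourierCoeff ((w t).jet 2) m‖ ≤ bracket m ^ 2 * ‖fourierCoeff (w t) m‖ :=
    fun t m => by
      rw [fourierCoeff_jet hs le_rfl]
      exact norm_jet_coeff_le le_rfl (w t) m
  have hWs : ∀ t, Summable fun m => ‖fourierCoeff ((w t).jet 2) m‖ := fun t =>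
    .of_nonneg_of_le (fun m => norm_nonneg _) (hWb t) (hsum (w t)).1
  have hWt : ∀ t, ∑' m, ‖fourierCoeff ((w t).jet 2) m‖ ≤ L := fun t => by
    refine ((hWs t).tsum_le_tsum (hWb t) (hsum (w t)).1).trans ((hsum (w t)).2.trans ?_)
    have := mul_le_mul_of_nonneg_left (hK t) hC₂
    linarith
  have hsn : ∀ t m, ‖fourierCoeff (star ((w t).jet 2) : C(Torus, ℂ)) m‖
      = ‖fourierCoeff ((w t).jet 2) (-m)‖ := fun t m => by
    rw [fourierCoeff_star, RCLike.norm_conj]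
  refine ⟨C₀ * (G * L) + C₀ * (H * L) + D₀ + D₂, by positivity, fun t k M => ?_⟩
  have hchain := fourierCoeff_sum_pderiv_mul (X := (w t).args) (X' := (w t).args')
    (fun P => (uniformDecay_poly hs hK hK0 P).summable (by linarith) t)
    (fourierCoeff_args' hs (w t)) F k
  have hchain' : Complex.I * k * fourierCoeff ((w t).poly F) k
      = fourierCoeff ((w t).poly (MvPolynomial.pderiv 0 F) * (w t).jet 1 : C(Torus, ℂ)) k
      + fourierCoeff ((w t).poly (MvPolynomial.pderiv 1 F) * (w t).jet 2 : C(Torus, ℂ)) k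
      + fourierCoeff ((w t).poly (MvPolynomial.pderiv 2 F) * star ((w t).jet 1) : C(Torus, ℂ)) k
      + fourierCoeff ((w t).poly (MvPolynomial.pderiv 3 F) * star ((w t).jet 2) : C(Torus, ℂ)) k := by
    rw [← fourierCoeff_add, ← fourierCoeff_add, ← fourierCoeff_add]
    refine Eq.trans hchain.symm ?_
    rw [Fin.sum_univ_four]
    rfl
  have b1 := hC _ _ G L hG0 hL0 (hG t) (hW t) (hWs t) (hWt t) k M
  have b2 := hC ((w t).poly (MvPolynomial.pderiv 3 F)) (star ((w t).jet 2)) H L hH0 hL0 (hH t)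
    (fun m => by
      rw [hsn, ← bracket_neg m]
      exact hW t (-m))
    (by simp_rw [hsn]; exact (Equiv.neg ℤ).summable_iff.2 (hWs t))
    (by
      simp_rw [hsn]
      exact ((Equiv.neg ℤ).tsum_eq fun m => ‖fourierCoeff ((w t).jet 2) m‖).trans_le (hWt t)) k M
  have b3 := hD0 t k
  have b4 := hD2 t k
  -- the two truncated convolutions, and the two terms without second derivatives
  have hid : Complex.I * k * fourierCoeff ((w t).poly F) k
        - ∑ m ∈ Finset.Icc (-(M : ℤ)) M,
          (fourierCoeff ((w t).poly (MvPolynomial.pderiv 1 F)) m * fourierCoeff ((w t).jet 2) (k - m)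
          + fourierCoeff ((w t).poly (MvPolynomial.pderiv 3 F)) m
            * conj (fourierCoeff ((w t).jet 2) (m - k)))
      = ((fourierCoeff ((w t).poly (MvPolynomial.pderiv 1 F) * (w t).jet 2 : C(Torus, ℂ)) k
          - ∑ m ∈ Finset.Icc (-(M : ℤ)) M, fourierCoeff ((w t).poly (MvPolynomial.pderiv 1 F)) m
            * fourierCoeff ((w t).jet 2) (k - m))
        + (fourierCoeff ((w t).poly (MvPolynomial.pderiv 3 F) * star ((w t).jet 2) : C(Torus, ℂ)) k
          - ∑ m ∈ Finset.Icc (-(M : ℤ)) M, fourierCoeff ((w t).poly (MvPolynomial.pderiv 3 F)) m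
            * fourierCoeff (star ((w t).jet 2) : C(Torus, ℂ)) (k - m)))
        + (fourierCoeff ((w t).poly (MvPolynomial.pderiv 0 F) * (w t).jet 1 : C(Torus, ℂ)) k
        + fourierCoeff ((w t).poly (MvPolynomial.pderiv 2 F) * star ((w t).jet 1) : C(Torus, ℂ)) k) := by
    rw [hchain', Finset.sum_add_distrib]
    simp_rw [fourierCoeff_star, neg_sub]
    ring
  rw [hid]
  refine (norm_add_le_of_le (norm_add_le_of_le b1 b2) (norm_add_le_of_le b3 b4)).trans ?_
  have p1 : 0 ≤ (D₀ + D₂) * (bracket k ^ (-(s - 2)) * (1 + M : ℝ) ^ (-(1 / 4) : ℝ)) := by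
    have := Real.rpow_pos_of_pos (bracket_pos k) (-(s - 2))
    positivity
  linarith

end

/-! ### The integrating factor and the interaction representation -/

/-- The gap between the dispersive frequencies `|k|^α` of different `|k|`. -/
theorem abs_rpow_sub_rpow_ge {α p q : ℝ} (hα : 1 ≤ α) (hp : 0 ≤ p) (hq : 0 ≤ q)
    (hpq : 1 ≤ |p - q|) : p ^ (α - 1) ≤ |p ^ α - q ^ α| := by
  have key : ∀ a b : ℝ, 0 ≤ b → b ≤ a → 1 ≤ a - b → a ^ (α - 1) ≤ a ^ α - b ^ α := by
    intro a b hb hab h1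
    have e : ∀ c : ℝ, 0 ≤ c → c ^ α = c ^ (α - 1) * c := fun c hc => by
      rw [← Real.rpow_add_one' hc (by linarith), sub_add_cancel]
    rw [e a (hb.trans hab), e b hb]
    have h2 : b ^ (α - 1) ≤ a ^ (α - 1) := Real.rpow_le_rpow hb hab (by linarith)
    have h3 : 0 ≤ a ^ (α - 1) := Real.rpow_nonneg (hb.trans hab) _
    nlinarith
  rcases le_total q p with h | h
  · rw [abs_of_nonneg (by linarith)] at hpq
    exact (key p q hq h hpq).trans (le_abs_self _)
  · rw [abs_of_nonpos (by linarith)] at hpq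
    rw [abs_sub_comm]
    refine le_trans ?_ ((key q p hp h (by linarith)).trans (le_abs_self _))
    exact Real.rpow_le_rpow hp h (by linarith)

/-- The integrating factor `exp(-iλ∫₀ᵗ a)` decays exponentially when `λ Im a ≤ -κ < 0`. -/
theorem exists_integratingFactor {a : ℝ → ℂ} (ha : Continuous a) {lam κ τ A : ℝ} (hκ : 0 ≤ κ)
    (hA : ∀ t ∈ Icc 0 τ, ‖a t‖ ≤ A) (him : ∀ t ∈ Icc 0 τ, lam * (a t).im ≤ -κ) :
    ∃ E : ℝ → ℂ, E 0 = 1 ∧ (∀ t, HasDerivAt E (-Complex.I * lam * a t * E t) t) ∧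
      (∀ t ∈ Icc 0 τ, ‖E t‖ ≤ Real.exp (-κ * t)) ∧
      ∀ t t', 0 ≤ t → t ≤ t' → t' ≤ τ →
        ‖E t' - E t‖ ≤ Real.exp (-κ * t) * (|lam| * A * (t' - t)) := by
  set P : ℝ → ℂ := fun t => ∫ r in (0)..t, a r with hP
  have hPd : ∀ t, HasDerivAt P (a t) t := fun t => (ha.integral_hasStrictDerivAt 0 t).hasDerivAt
  set E : ℝ → ℂ := fun t => Complex.exp (-Complex.I * lam * P t) with hE
  have hEd : ∀ t, HasDerivAt E (-Complex.I * lam * a t * E t) t := fun t => by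
    have := ((hPd t).const_mul (-Complex.I * (lam : ℂ))).cexp
    convert! this using 1
    ring
  have hnorm : ∀ t ∈ Icc 0 τ, ‖E t‖ ≤ Real.exp (-κ * t) := by
    intro t ht
    have h1 : (P t).im = ∫ r in (0)..t, (a r).im :=
      (Complex.imCLM.intervalIntegral_comp_comm (ha.intervalIntegrable 0 t)).symm
    have h2 : (-Complex.I * lam * P t).re = lam * (P t).im := by
      simp [Complex.mul_re, Complex.mul_im]
    rw [hE]
    simp only
    rw [Complex.norm_exp, h2, h1, ← intervalIntegral.integral_const_mul]
    refine Real.exp_le_exp.2 ?_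
    have hc : Continuous fun r => lam * (a r).im :=
      continuous_const.mul (Complex.continuous_im.comp ha)
    have h3 := intervalIntegral.integral_mono_on ht.1 (hc.intervalIntegrable 0 t)
      (continuous_const.intervalIntegrable (μ := volume) 0 t)
      fun r hr => him r ⟨hr.1, hr.2.trans ht.2⟩
    rw [intervalIntegral.integral_const, smul_eq_mul] at h3
    linarith
  refine ⟨E, by simp [hE, hP], hEd, hnorm, fun t t' ht htt' ht' => ?_⟩
  have := norm_image_sub_le_of_norm_deriv_le_segment' (f := E) (a := t) (b := t')
    (C := Real.exp (-κ * t) * (|lam| * A)) (fun r _ => (hEd r).hasDerivWithinAt)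
    (fun r hr => by
      have hr' : r ∈ Icc 0 τ := ⟨ht.trans hr.1, hr.2.le.trans ht'⟩
      have h1 : ‖E r‖ ≤ Real.exp (-κ * t) := (hnorm r hr').trans
        (Real.exp_le_exp.2 (by nlinarith [hr.1]))
      rw [norm_mul, norm_mul, norm_mul, norm_neg, Complex.norm_I, one_mul, Complex.norm_real,
        Real.norm_eq_abs]
      calc |lam| * ‖a r‖ * ‖E r‖ ≤ |lam| * A * Real.exp (-κ * t) := by
            have h2 := hA r hr'
            have h3 : 0 ≤ A := (norm_nonneg _).trans h2
            gcongr
        _ = _ := by ring) t' (right_mem_Icc.2 htt')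
  linarith

theorem norm_exp_I_mul (x t : ℝ) : ‖Complex.exp (Complex.I * x * t)‖ = 1 := by
  have : Complex.I * x * t = ((x * t : ℝ) : ℂ) * Complex.I := by push_cast; ring
  rw [this, Complex.norm_exp_ofReal_mul_I]

section

variable {s α T σ : ℝ} {F : MvPolynomial (Fin 4) ℂ} {φ : Sobolev s} {w : ℝ → Sobolev s}

/-- The interaction representation `v_k(t) = e^{iσ|k|^α t} û(t,k)` removes the dispersion: its time
derivative is a mode of the nonlinearity. -/
theorem ModeSolution.exists_interaction (hs : 5 / 2 < s) (hσ : |σ| = 1)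
    (h : ModeSolution α F φ T σ w) :
    ∃ v : ℤ → ℝ → ℂ, ∃ B : ℝ, 0 ≤ B ∧ ∀ k, Continuous (v k) ∧ v k 0 = fourierCoeff φ k ∧
      (∀ t ∈ Icc 0 T, fourierCoeff (w t) k
        = Complex.exp (-(Complex.I * (σ * |(k : ℝ)| ^ α : ℝ) * t)) * v k t) ∧
      (∀ t ∈ Icc 0 T, HasDerivAt (v k) (Complex.exp (Complex.I * (σ * |(k : ℝ)| ^ α : ℝ) * t)
        * (σ * fourierCoeff ((w t).poly F) k)) t) ∧
      (∀ t ∈ Icc 0 T, ‖v k t‖ ≤ B * bracket k ^ (-s)) ∧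
      ∀ t ∈ Icc 0 T, ∀ t' ∈ Icc 0 T, t ≤ t' →
        ‖v k t' - v k t‖ ≤ B * bracket k ^ (-(s - 1)) * (t' - t) := by
  obtain ⟨K, hK0, hK⟩ := h.bounded
  obtain ⟨N, hN0, hN⟩ := h.norm_nonlinearity_le hs
  set c : ℤ → ℝ → ℂ := fun k t =>
    fourierCoeff φ k + ∫ r in (0)..t, (σ : ℂ) * modeRHS α F k (w r) with hc
  have hcd : ∀ k t, HasDerivAt (c k) ((σ : ℂ) * modeRHS α F k (w t)) t := fun k t =>
    ((continuous_modeRHS_comp hs h k).integral_hasStrictDerivAt 0 t).hasDerivAt.const_add _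
  have hcw : ∀ k, ∀ t ∈ Icc 0 T, fourierCoeff (w t) k = c k t := fun k t ht => h.eq k t ht
  set e : ℤ → ℝ → ℂ := fun k t => Complex.exp (Complex.I * (σ * |(k : ℝ)| ^ α : ℝ) * t) with he
  have hen : ∀ k t, ‖e k t‖ = 1 := fun k t => norm_exp_I_mul _ t
  have hed : ∀ k t, HasDerivAt (e k) (Complex.I * (σ * |(k : ℝ)| ^ α : ℝ) * e k t) t := by
    intro k t
    have := ((Complex.ofRealCLM.hasDerivAt (x := t)).const_mul
      (Complex.I * ((σ * |(k : ℝ)| ^ α : ℝ) : ℂ))).cexp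
    convert! this using 1
    simp [he, mul_comm]
  set v : ℤ → ℝ → ℂ := fun k t => e k t * c k t with hv
  have hvd : ∀ k, ∀ t ∈ Icc 0 T,
      HasDerivAt (v k) (e k t * (σ * fourierCoeff ((w t).poly F) k)) t := by
    intro k t ht
    have := (hed k t).mul (hcd k t)
    convert! this using 1
    rw [modeRHS, hcw k t ht]
    push_cast
    ring
  refine ⟨v, K + N, by positivity, fun k => ⟨?_, ?_, ?_, hvd k, ?_, ?_⟩⟩
  · exact continuous_iff_continuousAt.2 fun t => ((hed k t).mul (hcd k t)).continuousAt
  · simp [hv, he, hc]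
  · intro t ht
    rw [hcw k t ht, hv]
    simp only [he]
    rw [← mul_assoc, ← Complex.exp_add, neg_add_cancel, Complex.exp_zero, one_mul]
  · intro t ht
    rw [hv]
    simp only
    rw [norm_mul, hen, one_mul, ← hcw k t ht]
    have hb := Real.rpow_pos_of_pos (bracket_pos k) (-s)
    refine (norm_fourierCoeff_sobolev_le (w t) k).trans ?_
    have := hK t
    gcongr
    linarith
  · intro t ht t' ht' htt'
    have := norm_image_sub_le_of_norm_deriv_le_segment' (f := v k) (a := t) (b := t')
      (C := (K + N) * bracket k ^ (-(s - 1)))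
      (fun r hr => (hvd k r ⟨ht.1.trans hr.1, hr.2.trans ht'.2⟩).hasDerivWithinAt)
      (fun r _ => by
        rw [norm_mul, norm_mul, hen, one_mul, Complex.norm_real, Real.norm_eq_abs, hσ, one_mul]
        have hb := Real.rpow_pos_of_pos (bracket_pos k) (-(s - 1))
        refine (hN r k).trans ?_
        gcongr
        linarith) t' (right_mem_Icc.2 htt')
    exact this

/-- The bound for one nonresonant interaction at frequency `x = |k|`. The half period `π/|Φ|` has to
be small compared with the time `1/x` on which the damping `E` and the profile `v` change, and so has
its `θ`-th power, the oscillation of the coefficient `g`: both quantities are `O(y)`. -/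
theorem norm_integral_nonresonant_le {x κ₀ B τ θ Φ y : ℝ} (hx : 1 ≤ x) (hκ₀ : 0 < κ₀) (hB : 0 ≤ B)
    (hτ : 0 ≤ τ) (hΦ : Φ ≠ 0) (hη₁ : x * (Real.pi / |Φ|) ≤ Real.pi * y)
    (hη₂ : (Real.pi / |Φ|) ^ θ ≤ Real.pi * y) {E g v : ℝ → ℂ}
    (hE : Continuous E) (hg : Continuous g) (hv : Continuous v)
    (hEb : ∀ t ∈ Icc 0 τ, ‖E t‖ ≤ Real.exp (-(κ₀ * x) * t))
    (hEd : ∀ t t', 0 ≤ t → t ≤ t' → t' ≤ τ →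
      ‖E t' - E t‖ ≤ Real.exp (-(κ₀ * x) * t) * (x * B * (t' - t)))
    (hgb : ∀ t ∈ Icc 0 τ, ‖g t‖ ≤ B)
    (hgd : ∀ t ∈ Icc 0 τ, ∀ t' ∈ Icc 0 τ, ‖g t' - g t‖ ≤ B * |t' - t| ^ θ)
    (hvb : ∀ t ∈ Icc 0 τ, ‖v t‖ ≤ B * x ^ (-s))
    (hvd : ∀ t ∈ Icc 0 τ, ∀ t' ∈ Icc 0 τ, t ≤ t' →
      ‖v t' - v t‖ ≤ B * x ^ (-(s - 1)) * (t' - t)) :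
    ‖∫ t in (0)..τ, E t * (g t * v t) * Complex.exp (Complex.I * Φ * t)‖
      ≤ Real.pi * (B ^ 2 + (B ^ 3 + 2 * B ^ 2) / κ₀) * (x ^ (-s) * y / x) := by
  have hx0 : 0 < x := by linarith
  have hη0 : 0 < Real.pi / |Φ| := div_pos Real.pi_pos (abs_pos.2 hΦ)
  set η := Real.pi / |Φ| with hη
  have hxs : 0 < x ^ (-s) := Real.rpow_pos_of_pos hx0 _
  have hxs1 : x ^ (-(s - 1)) = x ^ (-s) * x := by
    rw [← Real.rpow_add_one hx0.ne']; congr 1; ring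
  have hy : 0 ≤ Real.pi * y := (mul_nonneg hx0.le hη0.le).trans hη₁
  have hmem : ∀ t, 0 ≤ t → t + η ≤ τ → t ∈ Icc 0 τ ∧ t + η ∈ Icc 0 τ := fun t h1 h2 =>
    ⟨⟨h1, by linarith⟩, ⟨by linarith, h2⟩⟩
  have hmain := norm_integral_damped_oscillatory_le (Kg := B) (Kv := B * x ^ (-s))
    (L := x * B) (κ := κ₀ * x) (ωg := B * (Real.pi * y)) (ωv := B * (x ^ (-s) * x) * η)
    hτ hΦ (by positivity) (by positivity) (by positivity) (by positivity) (by positivity)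
    hE hg hv hEb hEd hgb hvb
    (fun t h1 h2 => by
      obtain ⟨m1, m2⟩ := hmem t h1 h2
      have := hgd t m1 _ m2
      rw [add_sub_cancel_left, abs_of_pos hη0] at this
      exact this.trans (mul_le_mul_of_nonneg_left hη₂ hB))
    (fun t h1 h2 => by
      obtain ⟨m1, m2⟩ := hmem t h1 h2
      have := hvd t m1 _ m2 (by linarith)
      rw [add_sub_cancel_left, hxs1] at this
      exact this)
  rw [← hη] at hmain
  refine hmain.trans ?_
  have h1 : B * (B * x ^ (-s)) * η ≤ B ^ 2 * x ^ (-s) * (Real.pi * y) / x := by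
    rw [le_div_iff₀ hx0]
    calc _ = B ^ 2 * x ^ (-s) * (x * η) := by ring
      _ ≤ _ := by gcongr
  have h2 : x * B * η * (B * (B * x ^ (-s)))
      + (B * (Real.pi * y) * (B * x ^ (-s)) + B * (B * (x ^ (-s) * x) * η))
      ≤ (B ^ 3 + 2 * B ^ 2) * (x ^ (-s) * (Real.pi * y)) := by
    calc _ = B ^ 3 * x ^ (-s) * (x * η) + B ^ 2 * x ^ (-s) * (Real.pi * y)
          + B ^ 2 * x ^ (-s) * (x * η) := by ring
      _ ≤ B ^ 3 * x ^ (-s) * (Real.pi * y) + B ^ 2 * x ^ (-s) * (Real.pi * y)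
          + B ^ 2 * x ^ (-s) * (Real.pi * y) := by gcongr
      _ = _ := by ring
  calc _ ≤ B ^ 2 * x ^ (-s) * (Real.pi * y) / x
        + (B ^ 3 + 2 * B ^ 2) * (x ^ (-s) * (Real.pi * y)) * (1 / (κ₀ * x)) := by gcongr
    _ = _ := by
        field_simp

end

/-! ### Decay of the initial datum along the growing frequencies -/

/-- Half of the exponent that one nonresonant interaction gains. The other half pays for the number
of the interactions, which is about `|k|^{gain α}`. -/
noncomputable def gain (α : ℝ) : ℝ := min (α - 2) (1 / (4 * α)) / 2

theorem gain_pos {α : ℝ} (hα : 2 < α) : 0 < gain α :=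
  half_pos (lt_min (by linarith) (by positivity))

theorem two_mul_gain_le_left (α : ℝ) : 2 * gain α ≤ α - 2 := by
  have := min_le_left (α - 2) (1 / (4 * α))
  rw [gain]; linarith

theorem two_mul_gain_le_right (α : ℝ) : 2 * gain α ≤ 1 / (4 * α) := by
  have := min_le_right (α - 2) (1 / (4 * α))
  rw [gain]; linarith

theorem gain_le_one {α : ℝ} (hα : 2 < α) : gain α ≤ 1 := by
  have h1 := two_mul_gain_le_right α
  have h2 : 1 / (4 * α) ≤ 1 := (div_le_one (by positivity)).2 (by linarith)
  linarith [gain_pos hα]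

/-- The half period of a phase `Φ` with `|Φ| ≥ x^{α-1}` is so short that one nonresonant interaction
gains the factor `x^{-2 gain α}`. -/
theorem half_period_bounds {α x Φ : ℝ} (hα : 2 < α) (hx : 1 ≤ x) (hΦ : x ^ (α - 1) ≤ |Φ|) :
    Φ ≠ 0 ∧ x * (Real.pi / |Φ|) ≤ Real.pi * x ^ (-(2 * gain α)) ∧
      (Real.pi / |Φ|) ^ (1 / (4 * α)) ≤ Real.pi * x ^ (-(2 * gain α)) := by
  have hx0 : 0 < x := by linarith
  have hp : 0 < x ^ (α - 1) := Real.rpow_pos_of_pos hx0 _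
  have hΦ0 : 0 < |Φ| := hp.trans_le hΦ
  have hη : Real.pi / |Φ| ≤ Real.pi * x ^ (-(α - 1)) := by
    rw [Real.rpow_neg hx0.le, ← div_eq_mul_inv]
    exact div_le_div_of_nonneg_left Real.pi_pos.le hp hΦ
  have hα0 : 0 < α := by linarith
  refine ⟨abs_pos.1 hΦ0, ?_, ?_⟩
  · calc x * (Real.pi / |Φ|) ≤ x * (Real.pi * x ^ (-(α - 1))) := by gcongr
      _ = Real.pi * (x ^ (1 : ℝ) * x ^ (-(α - 1))) := by rw [Real.rpow_one]; ring
      _ = Real.pi * x ^ (-(α - 2)) := by rw [← Real.rpow_add hx0]; congr 2; ring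
      _ ≤ _ := by
        have := two_mul_gain_le_left α
        gcongr
  · have h4 : 1 / (4 * α) ≤ 1 := (div_le_one (by positivity)).2 (by linarith)
    calc (Real.pi / |Φ|) ^ (1 / (4 * α)) ≤ (Real.pi * x ^ (-(α - 1))) ^ (1 / (4 * α)) := by
          have := Real.pi_pos
          gcongr
      _ = Real.pi ^ (1 / (4 * α)) * x ^ (-(α - 1) * (1 / (4 * α))) := by
          rw [Real.mul_rpow Real.pi_pos.le (by positivity), ← Real.rpow_mul hx0.le]
      _ ≤ Real.pi ^ (1 : ℝ) * x ^ (-(2 * gain α)) := by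
          have := two_mul_gain_le_right α
          have h5 : 0 < 1 / (4 * α) := by positivity
          have := Real.pi_gt_three
          gcongr
          · linarith
          · nlinarith
      _ = _ := by rw [Real.rpow_one]

/-- A cutoff `M` of the order of `x^{gain α}`: the number of low frequencies and the truncation error
are controlled. -/
theorem exists_cutoff {α x : ℝ} (hα : 2 < α) (hx : 1 ≤ x) : ∃ M : ℕ, 2 * (M : ℝ) ≤ x ∧
    2 * (M : ℝ) + 1 ≤ 2 * x ^ gain α ∧
    (1 + M : ℝ) ^ (-(1 / 4) : ℝ) ≤ 2 * x ^ (-(gain α / 4)) := by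
  have hx0 : 0 < x := by linarith
  have h1 : 1 ≤ x ^ gain α := Real.one_le_rpow hx (gain_pos hα).le
  have h2 : x ^ gain α ≤ x := by
    calc x ^ gain α ≤ x ^ (1 : ℝ) := Real.rpow_le_rpow_of_exponent_le hx (gain_le_one hα)
      _ = x := Real.rpow_one x
  have hM := Nat.floor_le (a := x ^ gain α / 2) (by positivity)
  have hM' := Nat.lt_floor_add_one (x ^ gain α / 2)
  refine ⟨⌊x ^ gain α / 2⌋₊, by linarith, by linarith, ?_⟩
  calc (1 + (⌊x ^ gain α / 2⌋₊ : ℝ)) ^ (-(1 / 4) : ℝ) ≤ (x ^ gain α / 2) ^ (-(1 / 4) : ℝ) :=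
        Real.rpow_le_rpow_of_nonpos (by positivity) (by linarith) (by norm_num)
    _ = (2 : ℝ) ^ (1 / 4 : ℝ) * x ^ (-(gain α / 4)) := by
        rw [div_eq_mul_inv, Real.mul_rpow (by positivity) (by positivity), ← Real.rpow_mul hx0.le,
          Real.inv_rpow (by norm_num), Real.rpow_neg (by norm_num), inv_inv, mul_comm]
        congr 2
        ring
    _ ≤ 2 ^ (1 : ℝ) * x ^ (-(gain α / 4)) := by
        gcongr <;> norm_num
    _ = _ := by rw [Real.rpow_one]

theorem exp_neg_le_one_div {z : ℝ} (hz : 0 < z) : Real.exp (-z) ≤ 1 / z := by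
  rw [Real.exp_neg, one_div]
  exact inv_anti₀ hz (by linarith [Real.add_one_le_exp z])

section

variable {s α T σ : ℝ} {F : MvPolynomial (Fin 4) ℂ} {φ : Sobolev s} {w : ℝ → Sobolev s}

set_option maxHeartbeats 2000000 in
/-- If the resonant term makes the `k`-th mode grow at the rate `κ₀|k|` on `[0,τ]`, then the `k`-th
coefficient of the initial datum is smaller than membership in `H^s` requires. Indeed the
integrating factor `E` decays at this rate, so that `φ̂(k) = E v_k - ∫ (E v_k)'` is governed by the
nonresonant interactions and by the truncation error. -/
theorem ModeSolution.norm_fourierCoeff_le_of_growing (hs : 5 / 2 < s) (hα : 2 < α) (hσ : |σ| = 1)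
    (h : ModeSolution α F φ T σ w) {τ κ₀ : ℝ} (hτ : 0 < τ) (hτT : τ ≤ T) (hκ₀ : 0 < κ₀) :
    ∃ C, 0 ≤ C ∧ ∀ k : ℤ, k ≠ 0 →
      (∀ t ∈ Icc 0 τ, σ * k * (fourierCoeff ((w t).poly (MvPolynomial.pderiv 1 F)) 0).im
        ≤ -(κ₀ * |(k : ℝ)|)) →
      ‖fourierCoeff φ k‖ ≤ C * |(k : ℝ)| ^ (-(s + gain α / 4)) := by
  obtain ⟨KG, hKG0, hKG, hKG'⟩ :=
    h.boundedHolder_poly hs (by linarith) hσ (MvPolynomial.pderiv 1 F)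
  obtain ⟨KH, hKH0, hKH, hKH'⟩ :=
    h.boundedHolder_poly hs (by linarith) hσ (MvPolynomial.pderiv 3 F)
  obtain ⟨v, Bv, hBv, hv⟩ := h.exists_interaction hs hσ
  obtain ⟨CR, hCR, hrem⟩ := h.norm_nonlinearity_sub_sum_le hs
  set B := KG + KH + 2 ^ s * Bv with hBdef
  have h2s : (1 : ℝ) ≤ 2 ^ s := Real.one_le_rpow (by norm_num) (by linarith)
  have hB : 0 ≤ B := by positivity
  have hKGB : KG ≤ B := by
    have : 0 ≤ 2 ^ s * Bv := by positivity
    linarith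
  have hKHB : KH ≤ B := by
    have : 0 ≤ 2 ^ s * Bv := by positivity
    linarith
  have hBvB : 2 ^ s * Bv ≤ B := by linarith
  -- the constant of `norm_integral_nonresonant_le`
  set C₁ := Real.pi * (B ^ 2 + (B ^ 3 + 2 * B ^ 2) / κ₀) with hC₁
  have hC₁0 : 0 ≤ C₁ := by have := Real.pi_pos; positivity
  refine ⟨16 * C₁ + 3 * CR / κ₀ + B / (κ₀ * τ), by positivity, fun k hk hgrow => ?_⟩
  set x := |(k : ℝ)| with hxdef
  have hx : 1 ≤ x := by rw [hxdef]; exact_mod_cast Int.one_le_abs hk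
  have hx0 : 0 < x := by linarith
  have hxs : 0 < x ^ (-s) := Real.rpow_pos_of_pos hx0 _
  obtain ⟨M, hMx, hMcard, hMr⟩ := exists_cutoff hα hx
  have hτsub : ∀ t ∈ Icc 0 τ, t ∈ Icc 0 T := fun t ht => ⟨ht.1, ht.2.trans hτT⟩
  -- the integrating factor
  have hpc : ∀ (P : MvPolynomial (Fin 4) ℂ) (m : ℤ),
      Continuous fun t => fourierCoeff ((w t).poly P) m := fun P m =>
    (coeffCLM m).continuous.comp ((continuous_poly hs P).comp h.continuous)
  have hWc : ∀ l : ℤ, Continuous fun t => fourierCoeff ((w t).jet 2) l := fun l =>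
    (coeffCLM l).continuous.comp ((continuous_jet hs le_rfl).comp h.continuous)
  set G : ℤ → ℝ → ℂ := fun m t => fourierCoeff ((w t).poly (MvPolynomial.pderiv 1 F)) m with hG
  set H : ℤ → ℝ → ℂ := fun m t => fourierCoeff ((w t).poly (MvPolynomial.pderiv 3 F)) m with hH
  set W : ℤ → ℝ → ℂ := fun l t => fourierCoeff ((w t).jet 2) l with hW
  set N : ℝ → ℂ := fun t => fourierCoeff ((w t).poly F) k with hN
  have hGc : ∀ m, Continuous (G m) := fun m => hpc _ m
  have hHc : ∀ m, Continuous (H m) := fun m => hpc _ m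
  have hNc : Continuous N := hpc _ k
  have hcoef : ∀ (f g : C(Torus, ℂ)) (m : ℤ),
      ‖fourierCoeff f m - fourierCoeff g m‖ ≤ ‖f - g‖ := fun f g m => by
    have := norm_fourierCoeff_le (f - g) m
    rwa [← coeffCLM_apply, map_sub] at this
  have hGb : ∀ m, ∀ t ∈ Icc 0 τ, ‖G m t‖ ≤ B := fun m t ht =>
    (norm_fourierCoeff_le _ m).trans ((hKG t (hτsub t ht)).trans hKGB)
  have hHb : ∀ m, ∀ t ∈ Icc 0 τ, ‖H m t‖ ≤ B := fun m t ht =>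
    (norm_fourierCoeff_le _ m).trans ((hKH t (hτsub t ht)).trans hKHB)
  have hGd : ∀ m, ∀ t ∈ Icc 0 τ, ∀ t' ∈ Icc 0 τ,
      ‖G m t' - G m t‖ ≤ B * |t' - t| ^ (1 / (4 * α)) := fun m t ht t' ht' =>
    (hcoef _ _ m).trans ((hKG' t' (hτsub t' ht') t (hτsub t ht)).trans (by gcongr))
  have hHd : ∀ m, ∀ t ∈ Icc 0 τ, ∀ t' ∈ Icc 0 τ,
      ‖H m t' - H m t‖ ≤ B * |t' - t| ^ (1 / (4 * α)) := fun m t ht t' ht' =>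
    (hcoef _ _ m).trans ((hKH' t' (hτsub t' ht') t (hτsub t ht)).trans (by gcongr))
  obtain ⟨E, hE0, hEd, hEb, hEL⟩ := exists_integratingFactor (lam := σ * k) (κ := κ₀ * x)
    (hGc 0) (by positivity) (hGb 0) hgrow
  have hlam : |σ * k| = x := by rw [abs_mul, hσ, one_mul]
  rw [hlam] at hEL
  have hEc : Continuous E := continuous_iff_continuousAt.2 fun t => (hEd t).continuousAt
  set e : ℝ → ℂ := fun t => Complex.exp (Complex.I * (σ * |(k : ℝ)| ^ α : ℝ) * t) with he
  have hec : Continuous e := by fun_prop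
  have hen : ∀ t, ‖e t‖ = 1 := fun t => norm_exp_I_mul _ t
  -- a single interaction with a frequency comparable to `k`
  have hterm : ∀ (g V : ℝ → ℂ) (l : ℤ) (Φ : ℝ), |k| ≤ 2 * |l| → |l| ≤ 2 * |k| →
      Continuous g → Continuous V → (∀ t ∈ Icc 0 τ, ‖g t‖ ≤ B) →
      (∀ t ∈ Icc 0 τ, ∀ t' ∈ Icc 0 τ, ‖g t' - g t‖ ≤ B * |t' - t| ^ (1 / (4 * α))) →
      (∀ t, ‖V t‖ = ‖v l t‖) → (∀ t t', ‖V t' - V t‖ = ‖v l t' - v l t‖) →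
      x ^ (α - 1) ≤ |Φ| →
      ‖(Complex.I * l) ^ 2 * ∫ t in (0)..τ, E t * (g t * V t) * Complex.exp (Complex.I * Φ * t)‖
        ≤ 4 * C₁ * (x ^ (-s) * x ^ (-(2 * gain α)) * x) := by
    intro g V l Φ hkl hlk hgc hVc hgb hgd hVn hVd hΦ
    obtain ⟨hΦ0, hη₁, hη₂⟩ := half_period_bounds hα hx hΦ
    have hbx : ∀ r : ℝ, 0 ≤ r → bracket k ^ (-r) ≤ x ^ (-r) := fun r hr =>
      Real.rpow_le_rpow_of_nonpos hx0 (abs_le_bracket k) (by linarith)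
    have hb1 : Bv * bracket l ^ (-s) ≤ B * x ^ (-s) := by
      have h1 := bracket_rpow_neg_le hkl (by linarith : 0 ≤ s)
      have h2 := hbx s (by linarith)
      calc Bv * bracket l ^ (-s) ≤ Bv * (2 ^ s * x ^ (-s)) := by
            gcongr
            exact h1.trans (by gcongr)
        _ = 2 ^ s * Bv * x ^ (-s) := by ring
        _ ≤ _ := by gcongr
    have hp1 := Real.rpow_pos_of_pos (bracket_pos k) (-s)
    have hp2 := Real.rpow_pos_of_pos (bracket_pos k) (-(s - 1))
    have hp3 := Real.rpow_pos_of_pos hx0 (-(s - 1))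
    have hb2 : Bv * bracket l ^ (-(s - 1)) ≤ B * x ^ (-(s - 1)) := by
      have h1 := bracket_rpow_neg_le hkl (by linarith : 0 ≤ s - 1)
      have h2 := hbx (s - 1) (by linarith)
      have h3 : (2 : ℝ) ^ (s - 1) ≤ 2 ^ s :=
        Real.rpow_le_rpow_of_exponent_le (by norm_num) (by linarith)
      calc Bv * bracket l ^ (-(s - 1)) ≤ Bv * (2 ^ s * x ^ (-(s - 1))) := by
            gcongr
            exact h1.trans (by gcongr)
        _ = 2 ^ s * Bv * x ^ (-(s - 1)) := by ring
        _ ≤ _ := by gcongr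
    have hI := norm_integral_nonresonant_le (s := s) (θ := 1 / (4 * α)) hx hκ₀ hB hτ.le hΦ0 hη₁ hη₂
      hEc hgc hVc hEb hEL hgb hgd
      (fun t ht => by
        rw [hVn]
        exact ((hv l).2.2.2.2.1 t (hτsub t ht)).trans hb1)
      (fun t ht t' ht' htt' => by
        rw [hVd]
        refine ((hv l).2.2.2.2.2 t (hτsub t ht) t' (hτsub t' ht') htt').trans ?_
        exact mul_le_mul_of_nonneg_right hb2 (by linarith))
    have hl : |(l : ℝ)| ≤ 2 * x := by rw [hxdef]; exact_mod_cast hlk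
    rw [norm_mul, norm_I_mul_pow]
    calc _ ≤ (2 * x) ^ 2 * (C₁ * (x ^ (-s) * x ^ (-(2 * gain α)) / x)) := by gcongr
      _ = _ := by field_simp; ring
  have hkM : ∀ m ∈ Finset.Icc (-(M : ℤ)) M, 2 * |m| ≤ |k| := by
    intro m hm
    rw [Finset.mem_Icc, ← abs_le] at hm
    have : 2 * (M : ℤ) ≤ |k| := by
      have : ((2 * M : ℤ) : ℝ) ≤ ((|k| : ℤ) : ℝ) := by push_cast; exact hMx
      exact_mod_cast this
    linarith
  have hlcmp : ∀ m ∈ Finset.Icc (-(M : ℤ)) M, |k| ≤ 2 * |k - m| ∧ |k - m| ≤ 2 * |k| := by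
    intro m hm
    have h1 := hkM m hm
    have h2 := abs_sub_abs_le_abs_sub k m
    have h3 := abs_sub k m
    constructor <;> omega
  -- `P₁` and `P₂` are the interactions through `F_ω` and `F_ω̄`, and `R` is the truncation error
  set I := Finset.Icc (-(M : ℤ)) M with hIdef
  set P₁ : ℤ → ℝ → ℂ := fun m t => E t * e t * (G m t * W (k - m) t) with hP₁
  set P₂ : ℤ → ℝ → ℂ := fun m t => E t * e t * (H m t * conj (W (m - k) t)) with hP₂
  set R : ℝ → ℂ := fun t => E t * e t * (Complex.I * k * N t
    - ∑ m ∈ I, (G m t * W (k - m) t + H m t * conj (W (m - k) t))) with hR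
  have hP₁c : ∀ m, Continuous (P₁ m) := fun m => (hEc.mul hec).mul ((hGc m).mul (hWc _))
  have hP₂c : ∀ m, Continuous (P₂ m) := fun m => (hEc.mul hec).mul
    ((hHc m).mul (Complex.continuous_conj.comp (hWc _)))
  have hRc : Continuous R := (hEc.mul hec).mul ((continuous_const.mul hNc).sub
    (continuous_finsetSum _ fun m _ => ((hGc m).mul (hWc _)).add
      ((hHc m).mul (Complex.continuous_conj.comp (hWc _)))))
  have hWv : ∀ l, ∀ t ∈ Icc 0 τ, W l t = (Complex.I * l) ^ 2
      * (Complex.exp (-(Complex.I * (σ * |(l : ℝ)| ^ α : ℝ) * t)) * v l t) := by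
    intro l t ht
    rw [← (hv l).2.2.1 t (hτsub t ht)]
    exact fourierCoeff_jet hs le_rfl (w t) l
  have hIcc : ∀ t ∈ uIcc 0 τ, t ∈ Icc 0 τ := fun t ht => by rwa [uIcc_of_le hτ.le] at ht
  have hb₁ : ∀ m ∈ I.erase 0, ‖∫ t in (0)..τ, P₁ m t‖
      ≤ 4 * C₁ * (x ^ (-s) * x ^ (-(2 * gain α)) * x) := by
    intro m hm
    rw [Finset.mem_erase] at hm
    obtain ⟨hkl, hlk⟩ := hlcmp m hm.2
    -- `|k - m| = |k|` is possible only for `m = 0` and for `m = 2k`, which is beyond the cutoff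
    have hne : |k| ≠ |k - m| := by
      intro heq
      have h1 := hkM m hm.2
      rcases abs_eq_abs.1 heq with h2 | h2
      · exact hm.1 (by omega)
      · have h3 : m = 2 * k := by omega
        rw [h3, abs_mul] at h1
        have : 0 < |k| := abs_pos.2 hk
        norm_num at h1
        omega
    have hΦ : x ^ (α - 1) ≤ |σ * |(k : ℝ)| ^ α - σ * |((k - m : ℤ) : ℝ)| ^ α| := by
      rw [← mul_sub, abs_mul, hσ, one_mul]
      refine abs_rpow_sub_rpow_ge (by linarith) (abs_nonneg _) (abs_nonneg _) ?_
      have h1 : (1 : ℤ) ≤ |(|k| - |k - m|)| := Int.one_le_abs (sub_ne_zero.2 hne)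
      have h2 : (1 : ℝ) ≤ |(|(k : ℝ)| - |((k - m : ℤ) : ℝ)|)| := by exact_mod_cast h1
      exact h2
    have ht := hterm (G m) (v (k - m)) (k - m) _ hkl hlk (hGc m) (hv _).1 (hGb m) (hGd m)
      (fun _ => rfl) (fun _ _ => rfl) hΦ
    rw [← intervalIntegral.integral_const_mul] at ht
    refine le_of_eq_of_le (congrArg norm (intervalIntegral.integral_congr fun t ht => ?_)) ht
    have hexp : Complex.exp (Complex.I * ((σ * |(k : ℝ)| ^ α - σ * |((k - m : ℤ) : ℝ)| ^ α : ℝ) : ℂ)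
        * t) = e t * Complex.exp (-(Complex.I * (σ * |((k - m : ℤ) : ℝ)| ^ α : ℝ) * t)) := by
      rw [he]
      simp only
      rw [← Complex.exp_add]
      congr 1
      push_cast
      ring
    simp only [hP₁]
    rw [hWv _ t (hIcc t ht), hexp]
    ring
  have hb₂ : ∀ m ∈ I, ‖∫ t in (0)..τ, P₂ m t‖
      ≤ 4 * C₁ * (x ^ (-s) * x ^ (-(2 * gain α)) * x) := by
    intro m hm
    obtain ⟨hkl, hlk⟩ := hlcmp m hm
    rw [abs_sub_comm] at hkl hlk
    -- conjugation reverses the second phase, so the phases add up and `m = 0` is nonresonant, too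
    have hΦ : x ^ (α - 1) ≤ |σ * |(k : ℝ)| ^ α + σ * |((m - k : ℤ) : ℝ)| ^ α| := by
      rw [← mul_add, abs_mul, hσ, one_mul]
      have h1 : 0 ≤ |((m - k : ℤ) : ℝ)| ^ α := by positivity
      have h2 : x ^ (α - 1) ≤ x ^ α := Real.rpow_le_rpow_of_exponent_le hx (by linarith)
      refine le_trans ?_ (le_abs_self _)
      rw [← hxdef]
      linarith
    have ht := hterm (H m) (fun t => conj (v (m - k) t)) (m - k) _ hkl hlk (hHc m)
      (Complex.continuous_conj.comp (hv _).1) (hHb m) (hHd m)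
      (fun _ => RCLike.norm_conj _)
      (fun _ _ => by rw [← map_sub]; exact RCLike.norm_conj _) hΦ
    rw [← intervalIntegral.integral_const_mul] at ht
    refine le_of_eq_of_le (congrArg norm (intervalIntegral.integral_congr fun t ht => ?_)) ht
    have hexp : Complex.exp (Complex.I * ((σ * |(k : ℝ)| ^ α + σ * |((m - k : ℤ) : ℝ)| ^ α : ℝ) : ℂ)
        * t) = e t * conj (Complex.exp (-(Complex.I * (σ * |((m - k : ℤ) : ℝ)| ^ α : ℝ) * t))) := by
      rw [he]
      simp only
      rw [← Complex.exp_conj, ← Complex.exp_add]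
      congr 1
      simp only [map_neg, map_mul, Complex.conj_I, Complex.conj_ofReal]
      push_cast
      ring
    simp only [hP₂]
    rw [hWv _ t (hIcc t ht), hexp]
    simp only [map_mul, map_pow, Complex.conj_I, map_intCast]
    ring
  have hbR : ‖∫ t in (0)..τ, R t‖ ≤ 3 * CR / κ₀ * (x ^ (-s) * x * x ^ (-(gain α / 4))) := by
    have hbx : ∀ r : ℝ, 0 ≤ r → bracket k ^ (-r) ≤ x ^ (-r) := fun r hr =>
      Real.rpow_le_rpow_of_nonpos hx0 (abs_le_bracket k) (by linarith)
    have e1 : x ^ (-(s - 2)) = x ^ (-s) * x ^ 2 := by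
      rw [← Real.rpow_two, ← Real.rpow_add hx0]; congr 1; ring
    have e2 : x ^ (-(s - 1)) = x ^ (-s) * x := by
      rw [← Real.rpow_add_one hx0.ne']; congr 1; ring
    have e3 : x ^ (-1 : ℝ) ≤ x ^ (-(gain α / 4)) :=
      Real.rpow_le_rpow_of_exponent_le hx (by linarith [gain_le_one hα])
    have e4 : x ≤ x ^ 2 * x ^ (-(gain α / 4)) := by
      calc x = x ^ 2 * x ^ (-1 : ℝ) := by rw [Real.rpow_neg_one]; field_simp
        _ ≤ _ := by gcongr
    set D := CR * (3 * (x ^ (-s) * x ^ 2 * x ^ (-(gain α / 4)))) with hD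
    have hbd : ∀ t ∈ Icc 0 τ, ‖R t‖ ≤ D * Real.exp (-(κ₀ * x) * t) := by
      intro t ht
      rw [hR]
      simp only
      rw [norm_mul, norm_mul, hen, mul_one, mul_comm]
      refine mul_le_mul ((hrem t k M).trans ?_) (hEb t ht) (norm_nonneg _) (by positivity)
      rw [hD]
      gcongr
      have h1 := hbx (s - 2) (by linarith)
      have h2 := hbx (s - 1) (by linarith)
      calc _ ≤ x ^ (-s) * x ^ 2 * (2 * x ^ (-(gain α / 4))) + x ^ (-s) * x := by
            rw [← e1, ← e2]; gcongr
        _ ≤ x ^ (-s) * x ^ 2 * (2 * x ^ (-(gain α / 4)))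
            + x ^ (-s) * (x ^ 2 * x ^ (-(gain α / 4))) := by gcongr
        _ = _ := by ring
    calc _ ≤ ∫ t in (0)..τ, D * Real.exp (-(κ₀ * x) * t) :=
          intervalIntegral.norm_integral_le_of_norm_le hτ.le
            (Eventually.of_forall fun t ht => hbd t ⟨ht.1.le, ht.2⟩)
            ((by fun_prop : Continuous fun t : ℝ =>
              D * Real.exp (-(κ₀ * x) * t)).intervalIntegrable _ _)
      _ ≤ D * (1 / (κ₀ * x)) := by
          rw [intervalIntegral.integral_const_mul]
          exact mul_le_mul_of_nonneg_left (integral_exp_neg_mul_le (by positivity)) (by positivity)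
      _ = _ := by
          rw [hD]
          field_simp
  -- Duhamel's formula for `E v_k`
  have hzd : ∀ t ∈ Icc 0 τ, HasDerivAt (fun t => E t * v k t)
      (-Complex.I * ((σ * k : ℝ) : ℂ) * G 0 t * E t * v k t + E t * (e t * (σ * N t))) t :=
    fun t ht => (hEd t).mul ((hv k).2.2.2.1 t (hτsub t ht))
  have hFTC := intervalIntegral.integral_eq_sub_of_hasDerivAt (fun t ht => hzd t (hIcc t ht))
    (Continuous.intervalIntegrable ((((continuous_const.mul (hGc 0)).mul hEc).mul (hv k).1).add
      (hEc.mul (hec.mul (continuous_const.mul hNc)))) 0 τ)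
  have h0I : (0 : ℤ) ∈ I := by rw [hIdef, Finset.mem_Icc]; omega
  -- `E` cancels the term with `m = 0` of the first sum
  have hsum : Complex.I * k * (E τ * v k τ - E 0 * v k 0)
      = σ * ((∑ m ∈ I.erase 0, ∫ t in (0)..τ, P₁ m t) + (∑ m ∈ I, ∫ t in (0)..τ, P₂ m t)
        + ∫ t in (0)..τ, R t) := by
    rw [← hFTC, ← intervalIntegral.integral_const_mul,
      ← intervalIntegral.integral_finsetSum fun m _ => (hP₁c m).intervalIntegrable _ _,
      ← intervalIntegral.integral_finsetSum fun m _ => (hP₂c m).intervalIntegrable _ _]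
    have i1 : IntervalIntegrable (fun t => ∑ m ∈ I.erase 0, P₁ m t) volume 0 τ :=
      (continuous_finsetSum _ fun m _ => hP₁c m).intervalIntegrable _ _
    have i2 : IntervalIntegrable (fun t => ∑ m ∈ I, P₂ m t) volume 0 τ :=
      (continuous_finsetSum _ fun m _ => hP₂c m).intervalIntegrable _ _
    have i3 : IntervalIntegrable (fun t => ∑ m ∈ I.erase 0, P₁ m t + ∑ m ∈ I, P₂ m t)
        volume 0 τ := i1.add i2
    rw [← intervalIntegral.integral_add i1 i2,
      ← intervalIntegral.integral_add i3 (hRc.intervalIntegrable 0 τ), ← intervalIntegral.integral_const_mul]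
    refine intervalIntegral.integral_congr fun t ht => ?_
    have htτ := hIcc t ht
    have hve : v k t = e t * fourierCoeff (w t) k := by
      rw [(hv k).2.2.1 t (hτsub t htτ), he]
      simp only
      rw [← mul_assoc, ← Complex.exp_add, add_neg_cancel, Complex.exp_zero, one_mul]
    have hWk : W k t = (Complex.I * k) ^ 2 * fourierCoeff (w t) k :=
      fourierCoeff_jet hs le_rfl (w t) k
    have hs1 : ∑ m ∈ I, (G m t * W (k - m) t + H m t * conj (W (m - k) t))
        = G 0 t * W k t + ∑ m ∈ I.erase 0, G m t * W (k - m) t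
          + ∑ m ∈ I, H m t * conj (W (m - k) t) := by
      rw [Finset.sum_add_distrib, ← Finset.add_sum_erase I _ h0I, sub_zero]
    simp only [hP₁, hP₂, hR]
    rw [hs1, hWk, hve, ← Finset.mul_sum, ← Finset.mul_sum]
    push_cast
    ring
  have hcard : (I.card : ℝ) ≤ 2 * x ^ gain α := by
    refine le_trans (le_of_eq ?_) hMcard
    rw [hIdef, Int.card_Icc]
    have : ((M : ℤ) + 1 - -(M : ℤ)).toNat = 2 * M + 1 := by omega
    rw [this]
    push_cast
    ring
  set Q := 4 * C₁ * (x ^ (-s) * x ^ (-(2 * gain α)) * x) with hQ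
  have hQ0 : 0 ≤ Q := by positivity
  have hsumb : ∀ (J : Finset ℤ) (P : ℤ → ℝ → ℂ), J ⊆ I →
      (∀ m ∈ J, ‖∫ t in (0)..τ, P m t‖ ≤ Q) →
      ‖∑ m ∈ J, ∫ t in (0)..τ, P m t‖ ≤ 2 * x ^ gain α * Q := by
    intro J P hJ hP
    refine (norm_sum_le_of_le _ hP).trans ?_
    rw [Finset.sum_const, nsmul_eq_mul]
    have : (J.card : ℝ) ≤ I.card := by exact_mod_cast Finset.card_le_card hJ
    gcongr
    exact this.trans hcard
  have hQx : x ^ gain α * Q ≤ 4 * C₁ * (x ^ (-s) * x * x ^ (-(gain α / 4))) := by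
    have e1 : x ^ gain α * x ^ (-(2 * gain α)) ≤ x ^ (-(gain α / 4)) := by
      rw [← Real.rpow_add hx0]
      exact Real.rpow_le_rpow_of_exponent_le hx (by linarith [gain_pos hα])
    calc x ^ gain α * Q = 4 * C₁ * (x ^ (-s) * x * (x ^ gain α * x ^ (-(2 * gain α)))) := by
          rw [hQ]; ring
      _ ≤ _ := by gcongr
  have hdiff : x * ‖E τ * v k τ - E 0 * v k 0‖
      ≤ (16 * C₁ + 3 * CR / κ₀) * (x ^ (-s) * x * x ^ (-(gain α / 4))) := by
    have e1 : x * ‖E τ * v k τ - E 0 * v k 0‖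
        = ‖Complex.I * k * (E τ * v k τ - E 0 * v k 0)‖ := by
      rw [norm_mul, norm_mul, Complex.norm_I, one_mul, Complex.norm_intCast]
    rw [e1, hsum, norm_mul, Complex.norm_real, Real.norm_eq_abs, hσ, one_mul]
    refine (norm_add_le_of_le (norm_add_le_of_le
      (hsumb _ _ (Finset.erase_subset _ _) hb₁) (hsumb _ _ subset_rfl hb₂)) hbR).trans ?_
    linarith
  -- the damping at time `τ` makes the end point negligible
  have hend : ‖E τ * v k τ‖ ≤ B / (κ₀ * τ) * (x ^ (-s) * x ^ (-(gain α / 4))) := by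
    have hτm : τ ∈ Icc 0 τ := ⟨hτ.le, le_rfl⟩
    have h1 := hEb τ hτm
    have h2 := (hv k).2.2.2.2.1 τ (hτsub τ hτm)
    have h3 : bracket k ^ (-s) ≤ x ^ (-s) :=
      Real.rpow_le_rpow_of_nonpos hx0 (abs_le_bracket k) (by linarith)
    have h4 : Real.exp (-(κ₀ * x) * τ) ≤ 1 / (κ₀ * x * τ) := by
      rw [neg_mul]
      exact exp_neg_le_one_div (by positivity)
    have h5 : Bv ≤ B := by nlinarith
    have h7 := Real.rpow_pos_of_pos (bracket_pos k) (-s)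
    have h6 : x ^ (-1 : ℝ) ≤ x ^ (-(gain α / 4)) :=
      Real.rpow_le_rpow_of_exponent_le hx (by linarith [gain_le_one hα])
    rw [norm_mul]
    calc ‖E τ‖ * ‖v k τ‖ ≤ 1 / (κ₀ * x * τ) * (B * x ^ (-s)) := by
          gcongr
          · exact h1.trans h4
          · exact h2.trans (by gcongr)
      _ = B / (κ₀ * τ) * (x ^ (-s) * x ^ (-1 : ℝ)) := by
          rw [Real.rpow_neg_one]; field_simp
      _ ≤ _ := by gcongr
  have hdiff' : ‖E τ * v k τ - E 0 * v k 0‖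
      ≤ (16 * C₁ + 3 * CR / κ₀) * (x ^ (-s) * x ^ (-(gain α / 4))) := by
    refine le_of_mul_le_mul_left (hdiff.trans (le_of_eq ?_)) hx0
    ring
  have hφ : fourierCoeff φ k = E τ * v k τ - (E τ * v k τ - E 0 * v k 0) := by
    rw [hE0, (hv k).2.1]
    ring
  have hfin : x ^ (-(s + gain α / 4)) = x ^ (-s) * x ^ (-(gain α / 4)) := by
    rw [← Real.rpow_add hx0]; congr 1; ring
  rw [hφ, hfin]
  refine (norm_sub_le_of_le hend hdiff').trans (le_of_eq ?_)
  ring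

end

section

variable {s α T σ : ℝ} {F : MvPolynomial (Fin 4) ℂ} {φ : Sobolev s} {w : ℝ → Sobolev s}

/-! ### The frequencies of one sign -/

theorem sobolev_ext {f g : Sobolev s} (h : ∀ k, fourierCoeff f k = fourierCoeff g k) : f = g := by
  refine Subtype.ext (fourierBasis.repr.injective (Subtype.ext (funext fun k => ?_)))
  have := h k
  rw [← fourierBasis_repr, ← fourierBasis_repr] at this
  exact this

theorem ModeSolution.apply_zero (h : ModeSolution α F φ T σ w) (hT : 0 ≤ T) : w 0 = φ :=
  sobolev_ext fun k => by
    have := h.eq k 0 ⟨le_rfl, hT⟩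
    rwa [intervalIntegral.integral_same, add_zero] at this

/-- If the mean of `Im F_ω` along the initial datum does not vanish, then the datum of a solution is
smoother than `H^s` at the frequencies of one sign. -/
theorem ModeSolution.exists_sign_norm_fourierCoeff_le (hs : 5 / 2 < s) (hα : 2 < α) (hσ : |σ| = 1)
    (hT : 0 < T) (h : ModeSolution α F φ T σ w)
    (hφ : (fourierCoeff (φ.poly (MvPolynomial.pderiv 1 F)) 0).im ≠ 0) :
    ∃ e : ℤ, |e| = 1 ∧ ∃ C : ℝ, ∀ n : ℕ, n ≠ 0 →
      ‖fourierCoeff φ (e * n)‖ ≤ C * (n : ℝ) ^ (-(s + gain α / 4)) := by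
  set a : ℝ → ℝ := fun t => (coeffCLM 0 ((w t).poly (MvPolynomial.pderiv 1 F))).im with ha
  have hac : Continuous a := Complex.continuous_im.comp
    ((coeffCLM 0).continuous.comp ((continuous_poly hs _).comp h.continuous))
  have ha0 : a 0 ≠ 0 := by
    simp only [ha, h.apply_zero hT.le]
    exact hφ
  have hb : 0 < |a 0| := abs_pos.2 ha0
  obtain ⟨δ, hδ, hδa⟩ := Metric.continuousAt_iff.1 (hac.continuousAt (x := 0))
    (|a 0| / 2) (half_pos hb)
  -- the sign of the frequencies that grow
  obtain ⟨e, he1, he⟩ : ∃ e : ℤ, |e| = 1 ∧ σ * e * a 0 = -|a 0| := by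
    rcases (abs_eq zero_le_one).1 hσ with rfl | rfl <;> rcases abs_cases (a 0) with ⟨h1, _⟩ | ⟨h1, _⟩
    · exact ⟨-1, by simp, by rw [h1]; simp⟩
    · exact ⟨1, by simp, by rw [h1]; simp⟩
    · exact ⟨1, by simp, by rw [h1]; simp⟩
    · exact ⟨-1, by simp, by rw [h1]; simp⟩
  have he1' : |(e : ℝ)| = 1 := by exact_mod_cast he1
  have hτ : 0 < min T (δ / 2) := lt_min hT (half_pos hδ)
  obtain ⟨C, -, hC⟩ := h.norm_fourierCoeff_le_of_growing hs hα hσ hτ (min_le_left _ _) (half_pos hb)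
  refine ⟨e, he1, C, fun n hn => ?_⟩
  have hn0 : (0 : ℝ) < n := by exact_mod_cast Nat.pos_of_ne_zero hn
  have he0 : e ≠ 0 := by rintro rfl; simp at he1
  have habs : |((e * n : ℤ) : ℝ)| = n := by
    push_cast
    rw [abs_mul, he1', one_mul, abs_of_pos hn0]
  have := hC (e * n) (mul_ne_zero he0 (by exact_mod_cast hn)) fun t ht => ?_
  · rwa [habs] at this
  rw [habs]
  have hta : dist (a t) (a 0) < |a 0| / 2 := hδa (by
    rw [Real.dist_eq, sub_zero, abs_of_nonneg ht.1]
    linarith [ht.2.trans (min_le_right _ _)])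
  rw [Real.dist_eq] at hta
  have h1 : σ * e * (a t - a 0) ≤ |a 0| / 2 := by
    refine (le_abs_self _).trans ?_
    rw [abs_mul, abs_mul, hσ, he1', one_mul, one_mul]
    exact hta.le
  change σ * ((e * n : ℤ) : ℝ) * a t ≤ _
  push_cast
  nlinarith

/-! ### A rough lacunary perturbation -/

theorem norm_sobolev_smul (c : ℂ) (f : Sobolev s) : ‖c • f‖ = ‖c‖ * ‖f‖ := by
  change ‖Sobolev.toEll2 s (c • f)‖ = ‖c‖ * ‖Sobolev.toEll2 s f‖
  rw [map_smul, norm_smul]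

theorem fourierCoeff_sobolev_add_smul (f g : Sobolev s) (c : ℂ) (k : ℤ) :
    fourierCoeff (f + c • g : Sobolev s) k = fourierCoeff f k + c * fourierCoeff g k := by
  simp only [map_add, map_smul, ← fourierBasis_repr, lp.coeFn_add, lp.coeFn_smul, Pi.add_apply,
    Pi.smul_apply, smul_eq_mul]

/-- Square summable weighted coefficients define an element of `H^s` (Riesz–Fischer). -/
theorem exists_sobolev_fourierCoeff_eq (hs : 0 ≤ s) {c : ℤ → ℂ}
    (hc : Summable fun k => bracket k ^ (2 * s) * ‖c k‖ ^ 2) :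
    ∃ f : Sobolev s, ∀ k, fourierCoeff f k = c k := by
  have hmem : Memℓp c 2 := by
    rw [memℓp_gen_iff (by simp)]
    refine Summable.of_nonneg_of_le (fun k => by positivity) (fun k => ?_) hc
    have h1 : 1 ≤ bracket k ^ (2 * s) := Real.one_le_rpow (one_le_bracket k) (by linarith)
    have h2 : ‖c k‖ ^ (2 : ℝ≥0∞).toReal = ‖c k‖ ^ 2 := by norm_num
    rw [h2]
    exact le_mul_of_one_le_left (by positivity) h1
  set g : Lp ℂ 2 μT := fourierBasis.repr.symm ⟨c, hmem⟩ with hg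
  have hgc : ∀ k, fourierCoeff g k = c k := fun k => by
    rw [← fourierBasis_repr, hg, LinearIsometryEquiv.apply_symm_apply]
  exact ⟨⟨g, by
    change Summable _
    simpa only [hgc] using hc⟩, hgc⟩

theorem summable_indicator_range_two_pow {ε : ℝ} (hε : 0 < ε) :
    Summable fun n : ℕ => (range fun j : ℕ => 2 ^ j).indicator
      (fun n : ℕ => bracket n ^ (-ε)) n := by
  have hinj : Function.Injective fun j : ℕ => (2 : ℕ) ^ j := Nat.pow_right_injective le_rfl
  rw [← hinj.summable_iff fun n hn => indicator_of_notMem hn _]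
  have hgeo : Summable fun j : ℕ => ((2 : ℝ) ^ (-ε)) ^ j :=
    summable_geometric_of_lt_one (by positivity)
      (Real.rpow_lt_one_of_one_lt_of_neg one_lt_two (by linarith))
  refine Summable.of_nonneg_of_le (fun j => ?_) (fun j => ?_) hgeo
  · exact indicator_nonneg (fun n _ => (Real.rpow_pos_of_pos (bracket_pos _) _).le) _
  · rw [Function.comp_apply, indicator_of_mem (mem_range_self j), ← Real.rpow_natCast,
      ← Real.rpow_mul zero_le_two, mul_comm, Real.rpow_mul zero_le_two, Real.rpow_natCast]
    refine Real.rpow_le_rpow_of_nonpos (by positivity) ?_ (by linarith)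
    refine le_trans ?_ (abs_le_bracket _)
    push_cast
    exact le_abs_self _

/-- Some `g ∈ H^s`, whose Fourier coefficients at the frequencies `±2^j` decay barely faster than
`|k|^{-s}`, makes every `ψ + r g` with `r > 0` equally rough: the phase of each coefficient of `g` is
chosen so that no cancellation with `ψ` takes place. -/
theorem exists_rough_perturbation (hs : 0 ≤ s) {ε : ℝ} (hε : 0 < ε) (ψ : Sobolev s) :
    ∃ g : Sobolev s, ∀ r : ℝ, 0 < r → ∀ e : ℤ, |e| = 1 → ∀ j : ℕ,
      r * bracket (e * (2 ^ j : ℕ)) ^ (-(s + ε))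
        ≤ ‖fourierCoeff (ψ + (r : ℂ) • g : Sobolev s) (e * (2 ^ j : ℕ))‖ := by
  classical
  set ς : ℤ → ℝ := fun k => if 0 ≤ (fourierCoeff ψ k).re then 1 else -1 with hς
  have hς1 : ∀ k, |ς k| = 1 := fun k => by simp only [hς]; split_ifs <;> simp
  set S : Set ℕ := range fun j : ℕ => 2 ^ j with hS
  set c : ℤ → ℂ := fun k =>
    if k.natAbs ∈ S then ((ς k * bracket k ^ (-(s + ε)) : ℝ) : ℂ) else 0 with hc
  have hcS : ∀ k : ℤ, bracket k ^ (2 * s) * ‖c k‖ ^ 2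
      = S.indicator (fun n : ℕ => bracket n ^ (-(2 * ε))) k.natAbs := fun k => by
    have hb := bracket_pos k
    have hkb : bracket (k.natAbs : ℤ) = bracket k := by
      rcases Int.natAbs_eq k with h | h
      · rw [← h]
      · rw [← bracket_neg, ← h]
    by_cases hk : k.natAbs ∈ S
    · rw [indicator_of_mem hk, hkb]
      simp only [hc, if_pos hk]
      rw [Complex.norm_real, Real.norm_eq_abs, abs_mul, hς1, one_mul, sq_abs, ← Real.rpow_natCast,
        ← Real.rpow_mul hb.le, ← Real.rpow_add hb]
      congr 1
      push_cast
      ring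
    · rw [indicator_of_notMem hk]
      simp only [hc, if_neg hk]
      simp
  have hsum := summable_indicator_range_two_pow (by linarith : 0 < 2 * ε)
  obtain ⟨g, hg⟩ := exists_sobolev_fourierCoeff_eq hs (c := c) (by
    simp only [hcS]
    exact Summable.of_nat_of_neg (by simpa using hsum) (by simpa using hsum))
  refine ⟨g, fun r hr e he j => ?_⟩
  set k : ℤ := e * (2 ^ j : ℕ) with hk
  have hkS : k.natAbs ∈ S := ⟨j, by
    have : e.natAbs = 1 := by rw [← Nat.cast_inj (R := ℤ), Int.natCast_natAbs, he, Nat.cast_one]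
    rw [hk, Int.natAbs_mul, this, one_mul, Int.natAbs_natCast]⟩
  have hck : fourierCoeff g k = ((ς k * bracket k ^ (-(s + ε)) : ℝ) : ℂ) := by
    rw [hg]
    simp only [hc, if_pos hkS]
  have hb := Real.rpow_pos_of_pos (bracket_pos k) (-(s + ε))
  rw [fourierCoeff_sobolev_add_smul, hck, ← Complex.ofReal_mul]
  refine le_trans ?_ (Complex.abs_re_le_norm _)
  rw [Complex.add_re, Complex.ofReal_re]
  have hrb : 0 < r * bracket k ^ (-(s + ε)) := mul_pos hr hb
  simp only [hς]
  split_ifs with h0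
  · refine le_trans ?_ (le_abs_self _)
    linarith
  · refine le_trans ?_ (neg_le_abs _)
    linarith

/-- Arbitrarily close to `ψ` there is a datum that is rough at the frequencies of both signs. -/
theorem exists_rough_datum (hs : 5 / 2 < s) {ε : ℝ} (hε : 0 < ε) {P : MvPolynomial (Fin 4) ℂ}
    {ψ : Sobolev s} (hψ : (fourierCoeff (ψ.poly P) 0).im ≠ 0) :
    ∃ φ : Sobolev s, (fourierCoeff (φ.poly P) 0).im ≠ 0 ∧
      ∀ e : ℤ, |e| = 1 → ∀ C : ℝ, ∃ n : ℕ, n ≠ 0 ∧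
        C * (n : ℝ) ^ (-(s + ε)) < ‖fourierCoeff φ (e * n)‖ := by
  obtain ⟨g, hg⟩ := exists_rough_perturbation (by linarith : 0 ≤ s) (half_pos hε) ψ
  have hc : Continuous fun f : Sobolev s => (coeffCLM 0 (f.poly P)).im :=
    Complex.continuous_im.comp ((coeffCLM 0).continuous.comp (continuous_poly hs P))
  obtain ⟨δ, hδ, hball⟩ := Metric.eventually_nhds_iff.1
    (hc.continuousAt.eventually_ne (x := ψ) (y := 0) hψ)
  have hg0 : 0 < ‖g‖ + 1 := by positivity
  set r := δ / (‖g‖ + 1) with hr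
  have hr0 : 0 < r := by positivity
  refine ⟨ψ + (r : ℂ) • g, hball ?_, fun e he C => ?_⟩
  · rw [dist_eq_norm, add_sub_cancel_left, norm_sobolev_smul, Complex.norm_real, Real.norm_eq_abs,
      abs_of_pos hr0, hr, div_mul_eq_mul_div, div_lt_iff₀ hg0]
    nlinarith
  -- along `n = 2^j` the lower bound exceeds `C n^{-(s+ε)}` by the factor `n^{ε/2}`
  · have hlim : Tendsto (fun j : ℕ => r * 2 ^ (-(s + ε / 2)) * ((2 : ℝ) ^ j) ^ (ε / 2)) atTop atTop :=
      ((tendsto_rpow_atTop (half_pos hε)).comp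
        (tendsto_pow_atTop_atTop_of_one_lt one_lt_two)).const_mul_atTop (by positivity)
    obtain ⟨j, hj⟩ := (hlim.eventually_gt_atTop C).exists
    refine ⟨2 ^ j, by positivity, lt_of_lt_of_le ?_ (hg r hr0 e he j)⟩
    have hx : (0 : ℝ) < 2 ^ j := by positivity
    have he0 : e ≠ 0 := by rintro rfl; simp at he
    have he1 : |(e : ℝ)| = 1 := by exact_mod_cast he
    have hb : bracket (e * (2 ^ j : ℕ)) ≤ 2 * 2 ^ j := by
      refine (bracket_le_two_mul_abs (mul_ne_zero he0 (by positivity))).trans (le_of_eq ?_)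
      push_cast
      rw [abs_mul, he1, one_mul, abs_of_pos hx]
    have hb' := Real.rpow_le_rpow_of_nonpos (bracket_pos _) hb
      (by linarith : -(s + ε / 2) ≤ 0)
    push_cast at hb' ⊢
    have hxp : (0 : ℝ) < (2 ^ j : ℝ) ^ (-(s + ε)) := Real.rpow_pos_of_pos hx _
    calc C * ((2 : ℝ) ^ j) ^ (-(s + ε))
        < r * 2 ^ (-(s + ε / 2)) * ((2 : ℝ) ^ j) ^ (ε / 2) * ((2 : ℝ) ^ j) ^ (-(s + ε)) :=
          mul_lt_mul_of_pos_right hj hxp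
      _ = r * (2 * 2 ^ j) ^ (-(s + ε / 2)) := by
          rw [Real.mul_rpow zero_le_two hx.le, mul_assoc, ← Real.rpow_add hx, ← mul_assoc]
          congr 2
          ring
      _ ≤ _ := mul_le_mul_of_nonneg_left hb' hr0.le

end

end FNLS

theorem theorem1p2 (α s : ℝ) (hα : 2 < α) (hs : max (α / 2 + 1) (5 / 2) < s)
    (F : MvPolynomial (Fin 4) ℂ)
    (hF : ∃ ψ : FNLS.Sobolev s,
      ∫ x, (FNLS.nonlinDw F (ψ x) (FNLS.dx ψ x)).im ∂FNLS.μT ≠ 0) :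
    ∃ φ : FNLS.Sobolev s, ∀ T : ℝ, 0 < T →
      (¬ ∃ u : ℝ → FNLS.Sobolev s,
        ContinuousOn u (Icc 0 T) ∧ FNLS.IsSolutionForward α F φ T u) ∧
      (¬ ∃ u : ℝ → FNLS.Sobolev s,
        ContinuousOn u (Icc (-T) 0) ∧ FNLS.IsSolutionBackward α F φ T u) := by
  have hs' : 5 / 2 < s := (le_max_right _ _).trans_lt hs
  obtain ⟨ψ, hψ⟩ := hF
  rw [FNLS.integral_im_nonlinDw hs'] at hψ
  have hε : 0 < FNLS.gain α / 4 := div_pos (FNLS.gain_pos hα) (by norm_num)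
  obtain ⟨φ, hφ, hrough⟩ := FNLS.exists_rough_datum hs' hε hψ
  have key : ∀ (T σ : ℝ) (w : ℝ → FNLS.Sobolev s), 0 < T → |σ| = 1 →
      ¬ FNLS.ModeSolution α F φ T σ w := by
    intro T σ w hT hσ h
    obtain ⟨e, he, C, hC⟩ := h.exists_sign_norm_fourierCoeff_le hs' hα hσ hT hφ
    obtain ⟨n, hn, hlt⟩ := hrough e he C
    exact (hC n hn).not_gt hlt
  refine ⟨φ, fun T hT => ⟨?_, ?_⟩⟩
  · rintro ⟨u, hu, hsol⟩
    exact key T 1 _ hT (by simp) (hsol.modeSolution hs' hT hu)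
  · rintro ⟨u, hu, hsol⟩
    exact key T (-1) _ hT (by simp) (hsol.modeSolution hs' hT hu)
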